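/- Let $G=(V,E)$ be a finite undirected simple graph (not necessarily connected) on $n$ vertices. The *gossip network* on $G$ with capacity $\lambda>0$ and *Yates weights* is the following process. Add a source $v_{\mathrm s}$ with an arc $(v_{\mathrm s},v)$ of weight $\lambda/n$ for each $v\in V$, and replace each edge $\{u,w\}$ of $G$ by the two arcs $(u,w)$, $(w,u)$ of weights $\lambda/\deg(u)$, $\lambda/\deg(w)$. The arcs carry mutually independent Poisson clocks, the rate of each clock being the weight of its arc. Put $N_v(0)=0$ for $v\in V$ and $N_{v_{\mathrm s}}(t)=t$ for all $t\ge 0$; whenever the clock of an arc $(u,v)$ rings at a time $t$, $N_v(t)$ is updated to $\max\{N_v(t),N_u(t)\}$. The age of information of $v$ is $X_v(t)=t-N_v(t)$. Let $B_m(v)$ be the set of vertices at graph distance at most $m$ from $v$ in $G$, and let $$m_*=m_*(v)=\min\{m:\ m\,|B_m(v)|\ge n\},\qquad \Phi_m(v)=\frac{|B_m(v)|}{|B_{m-1}(v)|}\quad(m\ge 1).$$ Let $\delta$ and $\Delta$ be the minimum and maximum degree of $G$. **Theorem.** (a) If $G$ has at least one edge, then for every $v\in V$, $\lambda>0$ and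 $t\ge 0$ the age $X_v(t)$ is integrable and $$\frac1{20}\min\left\{\frac{\delta}{\Delta},\ \frac1{\Phi_{m_*}(v)},\ \frac{\lambda t}{m_*}\right\}\ \le\ \frac{\lambda\,\mathbb E X_v(t)}{m_*}\ \le\ 3\Delta .$$ (b) Consequently, for bounded degree and large $t$, $\mathbb E X_v(t)=\Theta_\Delta(m_*/\lambda)$: for every $D\in\mathbb N$ there are constants $c,C>0$ depending only on $D$ such that, for every finite graph $G$ with maximum degree at most $D$, every $\lambda>0$ and every $v\in V$, for all sufficiently large $t$, $$c\,\frac{m_*(v)}{\lambda}\ \le\ \mathbb E X_v(t)\ \le\ C\,\frac{m_*(v)}{\lambda}.$$ -/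

import Mathlib

open MeasureTheory ProbabilityTheory Filter
open scoped NNReal

noncomputable section

namespace Gossip

/-! ### Poisson clocks -/

section Clock

variable {Ω : Type*}

/-- The number of rings in the time interval `(0, t]` of a clock with random set `R` of ring
times. -/
def ringCount (R : Ω → Set ℝ) (t : ℝ≥0) (ω : Ω) : ℕ :=
  (R ω ∩ Set.Ioc 0 (t : ℝ)).ncard

/-- `R` is the random set of ring times of a (homogeneous) Poisson process of rate `r` on
`(0, ∞)`: the rings are locally finite, and the counting process has independent increments,
the number of rings in `(s, t]` being Poisson distributed with mean `r (t - s)`. -/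
structure IsPoissonClock [MeasurableSpace Ω] (R : Ω → Set ℝ) (r : ℝ≥0) (μ : Measure Ω) :
    Prop where
  pos : ∀ ω, R ω ⊆ Set.Ioi 0
  locallyFinite : ∀ ω, ∀ t : ℝ, (R ω ∩ Set.Iic t).Finite
  measurable_count : ∀ t, Measurable (ringCount R t)
  law_increment : ∀ s t : ℝ≥0, s ≤ t →
    HasLaw (fun ω => ringCount R t ω - ringCount R s ω) (poissonMeasure (r * (t - s))) μ
  indep_increments : HasIndepIncrements (ringCount R) μ

end Clock

variable {V : Type*}

/-! ### The gossip network on an undirected graph -/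

/-- The arcs of the gossip network: `Sum.inl v` is the arc from the source to `v`, and
`Sum.inr d` is a directed edge of `G` (each edge of `G` gives two of them). -/
abbrev Arc (G : SimpleGraph V) : Type _ := V ⊕ G.Dart

variable {G : SimpleGraph V}

/-- The node at which an arc ends. -/
def Arc.head : Arc G → V
  | Sum.inl v => v
  | Sum.inr d => d.snd

/-- Yates weights: every node, the source included, splits the capacity `lam` equally among its
outgoing arcs. -/
def yatesWeight [Fintype V] (G : SimpleGraph V) [DecidableRel G.Adj] (lam : ℝ≥0) :
    Arc G → ℝ≥0
  | Sum.inl _ => lam / Fintype.card V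
  | Sum.inr d => lam / G.degree d.fst

/-- `R` is the family of clocks of the gossip network on `G` with Yates weights: mutually
independent Poisson clocks on all arcs, each with rate the weight of the arc. -/
structure IsYatesClocks [Fintype V] (G : SimpleGraph V) [DecidableRel G.Adj] (lam : ℝ≥0)
    {Ω : Type*} [MeasurableSpace Ω] (R : Arc G → Ω → Set ℝ) (μ : Measure Ω) : Prop where
  poisson : ∀ a, IsPoissonClock (R a) (yatesWeight G lam a) μ
  indep : iIndepFun (fun (a : Arc G) (ω : Ω) (t : ℝ≥0) => ringCount (R a) t ω) μ

/-! ### The gossip dynamics, for given ring times of all arcs -/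

/-- The timestamp that the tail of an arc holds at time `s`, when the non-source nodes hold the
timestamps `N`: the source always holds the timestamp `s`. -/
def tailStamp (N : V → ℝ) (s : ℝ) : Arc G → ℝ
  | Sum.inl _ => s
  | Sum.inr d => N d.fst

/-- The update at time `s`: for each arc that rings at time `s`, its head keeps the larger one of
its own timestamp and that of the tail. The supremum is over a nonempty set, finite if `V` is
(almost surely at most one arc rings at a time). -/
def update (ring : Arc G → Set ℝ) (N : V → ℝ) (s : ℝ) (v : V) : ℝ :=
  sSup (insert (N v) {x | ∃ a : Arc G, s ∈ ring a ∧ a.head = v ∧ x = tailStamp N s a})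

open Classical in
/-- The times in `(0, t]` at which some arc rings (a finite set, if `V` is finite and every arc
has locally finitely many rings). -/
def ringTimes (ring : Arc G → Set ℝ) (t : ℝ) : Finset ℝ :=
  if h : {s : ℝ | 0 < s ∧ s ≤ t ∧ ∃ a, s ∈ ring a}.Finite then h.toFinset else ∅

/-- The timestamps `N_v(t)`: they start at `0`, and the updates at the ring times in `(0, t]` are
carried out in increasing order of time. -/
def timestamp (ring : Arc G → Set ℝ) (t : ℝ) : V → ℝ :=
  ((ringTimes ring t).sort (· ≤ ·)).foldl (update ring) (fun _ => 0)

/-- The age of information `X_v(t) = t - N_v(t)`. -/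
def age (ring : Arc G → Set ℝ) (v : V) (t : ℝ) : ℝ := t - timestamp ring t v

/-! ### Graph quantities -/

/-- `|B_m(v)|`, the number of nodes at graph distance at most `m` from `v` (nodes in other
components are at infinite distance). -/
def ballCard (G : SimpleGraph V) (v : V) (m : ℕ) : ℕ :=
  {u : V | G.edist u v ≤ (m : ℕ∞)}.ncard

/-- `m_*(v) = min {m : |B_m(v)| m ≥ |V|}`. -/
def mStar [Fintype V] (G : SimpleGraph V) (v : V) : ℕ :=
  sInf {m : ℕ | Fintype.card V ≤ ballCard G v m * m}

/-- `Φ_m(v) = |B_m(v)| / |B_{m-1}(v)|`, for `m ≥ 1`. -/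
def ballRatio (G : SimpleGraph V) (v : V) (m : ℕ) : ℝ :=
  (ballCard G v m : ℝ) / (ballCard G v (m - 1) : ℝ)

end Gossip

end

noncomputable section

namespace Gossip

variable {V : Type*} {G : SimpleGraph V}

/-! ### The dynamics for given ring times -/

/-! Both bounds are proved for a dynamics on a time grid, where independent Bernoulli variables tell
which arcs ring in each cell; then the mesh tends to 0. Almost surely no two arcs ring in one cell
once the mesh is fine (`ae_eventually_unique_arc`), and then true and grid timestamps differ by at
most one mesh (`timestamp_le_gridStamp_le`). Grid ages are bounded by t, so expectations converge
(`tendsto_integral_gridAge`).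

Upper bound. Follow the information at v backwards in time: S starts as {v} and absorbs the tails of
ringing arcs that end in S, until the source rings into S. Let m = m_*, B = B_m(v), and let D ≥ 1
bound the degrees. Consider the potential (D/λ) · (mean over u ∈ B of the distance from S to u) +
m/λ. Each u ∈ B \ S gets closer at rate at least λ/D, which lowers the potential at rate at least |B
\ S|/|B|. The source hits S at rate λ|S|/n and wipes out at least m/λ, a gain of m|S|/n ≥ |S|/|B|.
The two gains add up to at least 1, so the potential bounds the expected age (`potential_step`,
`integral_setAge_le`). At S = {v} it is at most (D + 1)m/λ.

Lower bound. If v has age below a, then during the last a units of time either the source rang into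
B_{m-1}(v), or information travelled to v from outside this ball. The first has probability at most
aλ|B_{m-1}|/n, which minimality of m_* controls. For the second, a union bound weighted by
θ^distance gives exp(aDλθ/δ)/θ^m (`real_reachedFromOutside_le`). For θ = 6 and a suitable a of order
m/λ, probability 3/10 remains for age at least a. Since minimality bounds |B_{m-1}| directly, this
works without the term 1/Φ. -/

instance finite_arc [Finite V] : Finite (Arc G) := by
  classical
  have := Fintype.ofFinite V
  infer_instance

lemma finite_stamps [Finite V] (ring : Arc G → Set ℝ) (N : V → ℝ) (s : ℝ) (v : V) :
    (insert (N v) {x | ∃ a : Arc G, s ∈ ring a ∧ a.head = v ∧ x = tailStamp N s a}).Finite := by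
  refine Set.Finite.insert _ ((Set.finite_range (tailStamp (G := G) N s)).subset ?_)
  rintro x ⟨a, -, -, rfl⟩
  exact ⟨a, rfl⟩

lemma le_update_self [Finite V] (ring : Arc G → Set ℝ) (N : V → ℝ) (s : ℝ) (v : V) :
    N v ≤ update ring N s v :=
  le_csSup (finite_stamps ring N s v).bddAbove (Set.mem_insert _ _)

lemma tailStamp_le_update [Finite V] {ring : Arc G → Set ℝ} (N : V → ℝ) {s : ℝ} {a : Arc G}
    (h : s ∈ ring a) : tailStamp N s a ≤ update ring N s a.head :=
  le_csSup (finite_stamps ring N s _).bddAbove (Set.mem_insert_of_mem _ ⟨a, h, rfl, rfl⟩)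

lemma update_le {ring : Arc G → Set ℝ} {N : V → ℝ} {s c : ℝ} {v : V} (h : N v ≤ c)
    (h' : ∀ a : Arc G, s ∈ ring a → a.head = v → tailStamp N s a ≤ c) :
    update ring N s v ≤ c := by
  refine csSup_le (Set.insert_nonempty _ _) ?_
  rintro x (rfl | ⟨a, ha, hv, rfl⟩)
  · exact h
  · exact h' a ha hv

lemma lt_update_iff [Finite V] {ring : Arc G → Set ℝ} {N : V → ℝ} {s c : ℝ} {v : V} :
    c < update ring N s v ↔
      c < N v ∨ ∃ a : Arc G, s ∈ ring a ∧ a.head = v ∧ c < tailStamp N s a := by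
  constructor
  · contrapose!
    rintro ⟨h, h'⟩
    exact update_le h h'
  · rintro (h | ⟨a, ha, rfl, h⟩)
    · exact h.trans_le (le_update_self _ _ _ _)
    · exact h.trans_le (tailStamp_le_update N ha)

lemma tailStamp_mono (N : V → ℝ) (a : Arc G) {s s' : ℝ} (h : s ≤ s') :
    tailStamp N s a ≤ tailStamp N s' a := by
  cases a <;> simp [tailStamp, h]

/-- A simple graph has no loops, so the tail of an arc is never its head. -/
lemma tailStamp_congr {N N' : V → ℝ} {a : Arc G} (h : ∀ v ≠ a.head, N' v = N v) (s : ℝ) :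
    tailStamp N' s a = tailStamp N s a := by
  cases a with
  | inl v => rfl
  | inr d => exact h _ d.adj.ne

lemma update_of_ne [Finite V] {ring : Arc G → Set ℝ} {a : Arc G} {s : ℝ}
    (h : ∀ b, s ∈ ring b → b = a) (N : V → ℝ) {v : V} (hv : v ≠ a.head) :
    update ring N s v = N v := by
  refine le_antisymm (update_le le_rfl ?_) (le_update_self _ _ _ _)
  intro b hb hbv
  exact absurd (h b hb ▸ hbv.symm) hv

lemma update_head [Finite V] {ring : Arc G → Set ℝ} {a : Arc G} {s : ℝ}
    (h : ∀ b, s ∈ ring b ↔ b = a) (N : V → ℝ) :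
    update ring N s a.head = max (N a.head) (tailStamp N s a) := by
  refine le_antisymm (update_le (le_max_left _ _) ?_)
    (max_le (le_update_self _ _ _ _) (tailStamp_le_update N ((h a).2 rfl)))
  intro b hb _
  rw [(h b).1 hb]
  exact le_max_right _ _

/-- Repeated rings of a single arc do not compound: only its head changes, and the stamp of its tail
stays fixed or, for the source, runs from c to e. -/
lemma foldl_update_of_unique [Finite V] {ring : Arc G → Set ℝ} {a : Arc G} {c e : ℝ}
    (l : List ℝ) (hl : ∀ s ∈ l, c ≤ s ∧ s ≤ e ∧ ∀ b, s ∈ ring b ↔ b = a) (N : V → ℝ) :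
    (∀ v ≠ a.head, l.foldl (update ring) N v = N v) ∧
      N a.head ≤ l.foldl (update ring) N a.head ∧
      l.foldl (update ring) N a.head ≤ max (N a.head) (tailStamp N e a) ∧
      (l ≠ [] → tailStamp N c a ≤ l.foldl (update ring) N a.head) := by
  induction l generalizing N with
  | nil => simp
  | cons s l ih =>
    obtain ⟨hcs, hse, hs⟩ := hl s (by simp)
    obtain ⟨h1, h2, h3, -⟩ := ih (fun s' hs' => hl s' (by simp [hs'])) (update ring N s)
    have hne : ∀ v ≠ a.head, update ring N s v = N v := fun v hv =>
      update_of_ne (fun b hb => (hs b).1 hb) N hv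
    rw [tailStamp_congr hne] at h3
    rw [update_head hs] at h2 h3
    simp only [List.foldl_cons]
    refine ⟨fun v hv => (h1 v hv).trans (hne v hv), (le_max_left _ _).trans h2, h3.trans ?_,
      fun _ => ?_⟩
    · exact max_le (max_le_max_left _ (tailStamp_mono N a hse)) (le_max_right _ _)
    · exact (tailStamp_mono N a hcs).trans ((le_max_right _ _).trans h2)

lemma mem_ringTimes {ring : Arc G → Set ℝ} {t : ℝ}
    (h : {s : ℝ | 0 < s ∧ s ≤ t ∧ ∃ a, s ∈ ring a}.Finite) {s : ℝ} :
    s ∈ ringTimes ring t ↔ 0 < s ∧ s ≤ t ∧ ∃ a, s ∈ ring a := by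
  rw [ringTimes, dif_pos h, Set.Finite.mem_toFinset]
  rfl

lemma finite_ringTimes [Finite V] {ring : Arc G → Set ℝ}
    (h : ∀ a, ∀ t : ℝ, (ring a ∩ Set.Iic t).Finite) (t : ℝ) :
    {s : ℝ | 0 < s ∧ s ≤ t ∧ ∃ a, s ∈ ring a}.Finite := by
  refine (Set.finite_iUnion fun a => h a t).subset ?_
  rintro s ⟨-, hs, a, ha⟩
  exact Set.mem_iUnion.2 ⟨a, ha, hs⟩

lemma timestamp_eq_foldl [Finite V] {ring : Arc G → Set ℝ}
    (h : ∀ a, ∀ t : ℝ, (ring a ∩ Set.Iic t).Finite) {s t : ℝ} (hst : s ≤ t) :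
    timestamp ring t = (((ringTimes ring t).filter (s < ·)).sort (· ≤ ·)).foldl (update ring)
      (timestamp ring s) := by
  classical
  rw [timestamp, timestamp, ← List.foldl_append]
  congr 1
  refine List.Perm.eq_of_pairwise' (Finset.pairwise_sort _ _)
    (List.pairwise_append.2 ⟨Finset.pairwise_sort _ _, Finset.pairwise_sort _ _, ?_⟩) ?_
  · intro x hx y hy
    rw [Finset.mem_sort, mem_ringTimes (finite_ringTimes h s)] at hx
    rw [Finset.mem_sort, Finset.mem_filter] at hy
    exact hx.2.1.trans hy.2.le
  · refine (List.perm_ext_iff_of_nodup (Finset.sort_nodup _ _) ?_).2 ?_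
    · refine List.nodup_append.2 ⟨Finset.sort_nodup _ _, Finset.sort_nodup _ _, ?_⟩
      intro x hx y hy
      rw [Finset.mem_sort, mem_ringTimes (finite_ringTimes h s)] at hx
      rw [Finset.mem_sort, Finset.mem_filter] at hy
      exact (hx.2.1.trans_lt hy.2).ne
    · intro x
      rw [List.mem_append, Finset.mem_sort, Finset.mem_sort, Finset.mem_sort, Finset.mem_filter,
        mem_ringTimes (finite_ringTimes h s), mem_ringTimes (finite_ringTimes h t)]
      constructor
      · rintro ⟨h0, h1, h2⟩
        rcases le_or_gt x s with hx | hx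
        · exact Or.inl ⟨h0, hx, h2⟩
        · exact Or.inr ⟨⟨h0, h1, h2⟩, hx⟩
      · rintro (⟨h0, h1, h2⟩ | ⟨h0, -⟩)
        · exact ⟨h0, h1.trans hst, h2⟩
        · exact h0

/-! ### The dynamics on a time grid -/

/-- The timestamps of the gossip dynamics on the time grid of mesh `h`, where `x j a` says whether
the arc `a` rings in the cell `(j h, (j + 1) h]`; rings are treated as if they occurred at the
right endpoint of their cell. -/
def gridStamp (x : ℕ → Arc G → Bool) (h : ℝ) : ℕ → V → ℝ
  | 0 => fun _ => 0
  | j + 1 => update (fun a => {_s : ℝ | x j a = true}) (gridStamp x h j) ((j + 1 : ℕ) * h)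

lemma gridStamp_congr {x y : ℕ → Arc G → Bool} {h : ℝ} {j : ℕ} (hxy : ∀ i < j, x i = y i) :
    gridStamp x h j = gridStamp y h j := by
  induction j with
  | zero => rfl
  | succ j ih =>
    rw [gridStamp, gridStamp, ih fun i hi => hxy i (by omega), hxy j (by omega)]

lemma gridStamp_nonneg [Finite V] (x : ℕ → Arc G → Bool) (h : ℝ) (j : ℕ) (v : V) :
    0 ≤ gridStamp x h j v := by
  induction j with
  | zero => exact le_rfl
  | succ j ih => exact ih.trans (le_update_self _ _ _ _)

lemma gridStamp_le (x : ℕ → Arc G → Bool) {h : ℝ} (hh : 0 ≤ h) (j : ℕ) (v : V) :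
    gridStamp x h j v ≤ j * h := by
  induction j generalizing v with
  | zero => simp [gridStamp]
  | succ j ih =>
    have hj : (j : ℝ) * h ≤ ((j + 1 : ℕ) : ℝ) * h := by gcongr; omega
    refine update_le ((ih v).trans hj) ?_
    rintro (u | d) - -
    · exact le_rfl
    · exact (ih _).trans hj

/-- The error does not accumulate over cells. Rounding enters only through stamps issued by the
source, each raised by at most h; copying and taking maxima preserve a two-sided bound with gap h.
-/
lemma timestamp_le_gridStamp_le [Finite V] {ring : Arc G → Set ℝ}
    (hpos : ∀ a, ring a ⊆ Set.Ioi 0) (hfin : ∀ a, ∀ t : ℝ, (ring a ∩ Set.Iic t).Finite)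
    {h : ℝ} (hh : 0 ≤ h) {x : ℕ → Arc G → Bool} {n : ℕ}
    (hx : ∀ j < n, ∀ a, x j a = true ↔
      (ring a ∩ Set.Ioc (j * h) ((j + 1 : ℕ) * h)).Nonempty)
    (huniq : ∀ j < n, ∀ a b, x j a = true → x j b = true → a = b) (j : ℕ) (hj : j ≤ n) (v : V) :
    timestamp ring (j * h) v ≤ gridStamp x h j v ∧
      gridStamp x h j v ≤ timestamp ring (j * h) v + h := by
  induction j generalizing v with
  | zero =>
    have : ringTimes ring 0 = ∅ := by
      ext s
      rw [mem_ringTimes (finite_ringTimes hfin 0)]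
      constructor
      · rintro ⟨h0, h1, -⟩
        exact absurd h0 h1.not_gt
      · simp
    simp [timestamp, gridStamp, this, hh]
  | succ j ih =>
    replace ih := ih (by omega)
    have hle : (j : ℝ) * h ≤ ((j + 1 : ℕ) : ℝ) * h := by gcongr; omega
    have hj1 : ((j + 1 : ℕ) : ℝ) * h = j * h + h := by push_cast; ring
    have hmem : ∀ s, s ∈ ((ringTimes ring (((j + 1 : ℕ) : ℝ) * h)).filter (j * h < ·)).sort
        (· ≤ ·) ↔ s ∈ Set.Ioc (j * h) (((j + 1 : ℕ) : ℝ) * h) ∧ ∃ a, s ∈ ring a := by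
      intro s
      rw [Finset.mem_sort, Finset.mem_filter, mem_ringTimes (finite_ringTimes hfin _)]
      constructor
      · rintro ⟨⟨-, h2, h3⟩, h4⟩
        exact ⟨⟨h4, h2⟩, h3⟩
      · rintro ⟨⟨h4, h2⟩, a, h3⟩
        exact ⟨⟨hpos a h3, h2, a, h3⟩, h4⟩
    rw [timestamp_eq_foldl hfin hle, gridStamp]
    generalize ((ringTimes ring (((j + 1 : ℕ) : ℝ) * h)).filter (j * h < ·)).sort (· ≤ ·) = l
      at hmem
    by_cases hex : ∃ a, x j a = true
    · obtain ⟨a, ha⟩ := hex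
      have hl : ∀ s ∈ l, (j * h : ℝ) ≤ s ∧ s ≤ ((j + 1 : ℕ) : ℝ) * h ∧
          ∀ b, s ∈ ring b ↔ b = a := by
        intro s hs
        obtain ⟨hsI, b, hb⟩ := (hmem s).1 hs
        have key : ∀ b, s ∈ ring b → b = a := fun b hb =>
          huniq j hj b a ((hx j hj b).2 ⟨s, hb, hsI⟩) ha
        refine ⟨hsI.1.le, hsI.2, fun b' => ⟨key b', ?_⟩⟩
        rintro rfl
        exact key b hb ▸ hb
      have hne : l ≠ [] := by
        obtain ⟨s, hs, hsI⟩ := (hx j hj a).1 ha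
        exact List.ne_nil_of_mem ((hmem s).2 ⟨hsI, a, hs⟩)
      have hxa : ∀ b, (((j + 1 : ℕ) : ℝ) * h) ∈ (fun a => {_s : ℝ | x j a = true}) b ↔ b = a :=
        fun b => ⟨fun hb => huniq j hj b a hb ha, fun hb => hb ▸ ha⟩
      obtain ⟨h1, h2, h3, h4⟩ := foldl_update_of_unique l hl (timestamp ring (j * h))
      replace h4 := h4 hne
      by_cases hv : v = a.head
      · subst hv
        rw [update_head hxa]
        obtain ⟨i1, i2⟩ := ih a.head
        cases a with
        | inl u =>
          simp only [tailStamp] at h3 h4 ⊢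
          refine ⟨h3.trans (max_le_max_right _ i1), max_le (by linarith) (by linarith)⟩
        | inr d =>
          obtain ⟨k1, k2⟩ := ih d.fst
          simp only [tailStamp] at h3 h4 ⊢
          exact ⟨h3.trans (max_le_max i1 k1), max_le (by linarith) (by linarith)⟩
      · rw [update_of_ne (fun b hb => (hxa b).1 hb) _ hv, h1 v hv]
        exact ih v
    · push Not at hex
      have hnil : l = [] := by
        refine List.eq_nil_iff_forall_not_mem.2 fun s hs => ?_
        obtain ⟨hsI, b, hb⟩ := (hmem s).1 hs
        exact hex b ((hx j hj b).2 ⟨s, hb, hsI⟩)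
      have hup : update (fun a => {_s : ℝ | x j a = true}) (gridStamp x h j)
          (((j + 1 : ℕ) : ℝ) * h) v = gridStamp x h j v :=
        le_antisymm (update_le le_rfl fun a ha => absurd ha (hex a)) (le_update_self _ _ _ _)
      rw [hup, hnil]
      exact ih v

/-! ### Distances and balls in the graph -/

/-- The length of a shortest walk from a vertex of `S` to `u` (`0` if there is none). -/
def stepsFrom (G : SimpleGraph V) (S : Set V) (u : V) : ℕ :=
  sInf {k | ∃ s ∈ S, ∃ p : G.Walk s u, p.length = k}

lemma stepsFrom_le {S : Set V} {s u : V} (hs : s ∈ S) (p : G.Walk s u) :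
    stepsFrom G S u ≤ p.length :=
  Nat.sInf_le ⟨s, hs, p, rfl⟩

lemma exists_walk_stepsFrom {S : Set V} {s u : V} (hs : s ∈ S) (hu : G.Reachable s u) :
    ∃ s' ∈ S, ∃ p : G.Walk s' u, p.length = stepsFrom G S u := by
  obtain ⟨p⟩ := hu
  exact Nat.sInf_mem (s := {k | ∃ s ∈ S, ∃ p : G.Walk s u, p.length = k}) ⟨_, s, hs, p, rfl⟩

/-- Reachability matters: with no walk from S the value is the default 0, and enlarging S could
increase it. -/
lemma stepsFrom_anti {S T : Set V} (hST : S ⊆ T) {s u : V} (hs : s ∈ S) (hu : G.Reachable s u) :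
    stepsFrom G T u ≤ stepsFrom G S u := by
  obtain ⟨s', hs', p, hp⟩ := exists_walk_stepsFrom hs hu
  exact hp ▸ stepsFrom_le (hST hs') p

lemma exists_dart_stepsFrom_lt {S : Set V} {s u : V} (hs : s ∈ S) (hu : G.Reachable s u)
    (huS : u ∉ S) :
    ∃ d : G.Dart, d.snd ∈ S ∧ ∀ T : Set V, d.fst ∈ T → stepsFrom G T u + 1 ≤ stepsFrom G S u := by
  obtain ⟨s', hs', p, hp⟩ := exists_walk_stepsFrom hs hu
  cases p with
  | nil => exact absurd hs' huS
  | @cons _ w _ h q =>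
    -- The first step of a shortest walk, reversed: information flows into S, whereas the walk
    -- leaves S.
    refine ⟨⟨(w, s'), h.symm⟩, hs', fun T hT => ?_⟩
    rw [← hp, SimpleGraph.Walk.length_cons]
    exact Nat.succ_le_succ (stepsFrom_le hT q)

/-- The distance to `v`, truncated at `m`. -/
def level (G : SimpleGraph V) (v : V) (m : ℕ) (w : V) : ℕ := (min (G.edist w v) m).toNat

lemma coe_level (v : V) (m : ℕ) (w : V) : (level G v m w : ℕ∞) = min (G.edist w v) m :=
  ENat.natCast_toNat (ne_top_of_le_ne_top (ENat.natCast_ne_top m) (min_le_right _ _))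

lemma level_self (v : V) (m : ℕ) : level G v m v = 0 := by simp [level]

lemma level_le_add_one {u w : V} (h : G.Adj u w) (v : V) (m : ℕ) :
    level G v m u ≤ level G v m w + 1 := by
  have h1 : G.edist u v ≤ G.edist w v + 1 := by
    calc G.edist u v ≤ G.edist u w + G.edist w v := SimpleGraph.edist_triangle
      _ = G.edist w v + 1 := by rw [SimpleGraph.edist_eq_one_iff_adj.2 h, add_comm]
  have : (level G v m u : ℕ∞) ≤ ((level G v m w + 1 : ℕ) : ℕ∞) := by
    push_cast
    rw [coe_level, coe_level]
    rcases le_total (G.edist w v) m with h2 | h2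
    · rw [min_eq_left h2]
      exact (min_le_left _ _).trans h1
    · rw [min_eq_right h2]
      exact (min_le_right _ _).trans le_self_add
  exact_mod_cast this

lemma le_level_of_lt_edist {v w : V} {m : ℕ} (h : ((m - 1 : ℕ) : ℕ∞) < G.edist w v) :
    m ≤ level G v m w := by
  have : (m : ℕ∞) ≤ level G v m w := by
    rw [coe_level]
    refine le_min ?_ le_rfl
    have := Order.add_one_le_of_lt h
    refine le_trans ?_ this
    exact_mod_cast (by omega : m ≤ m - 1 + 1)
  exact_mod_cast this

lemma exists_walk_of_edist_le {u v : V} {m : ℕ} (h : G.edist u v ≤ m) :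
    ∃ p : G.Walk v u, p.length ≤ m := by
  have hr : G.Reachable u v :=
    SimpleGraph.edist_ne_top_iff_reachable.1 (ne_top_of_le_ne_top (ENat.natCast_ne_top m) h)
  obtain ⟨p, hp⟩ := hr.exists_walk_length_eq_edist
  refine ⟨p.reverse, ?_⟩
  rw [SimpleGraph.Walk.length_reverse]
  exact_mod_cast hp.le.trans h

/-! ### Balls and the minimality of m_* -/

section

variable [Fintype V]

open Classical in
/-- The ball of radius `m` around `v`. -/
def ball (G : SimpleGraph V) (v : V) (m : ℕ) : Finset V := {u | G.edist u v ≤ (m : ℕ∞)}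

lemma mem_ball {v u : V} {m : ℕ} : u ∈ ball G v m ↔ G.edist u v ≤ m := by simp [ball]

lemma card_ball (v : V) (m : ℕ) : (ball G v m).card = ballCard G v m := by
  rw [ballCard, ← Set.ncard_coe_finset]
  congr 1
  ext u
  simp [mem_ball]

lemma ballCard_pos (v : V) (m : ℕ) : 0 < ballCard G v m := by
  rw [← card_ball]
  exact Finset.card_pos.2 ⟨v, mem_ball.2 (by simp)⟩

lemma card_le_ballCard_mul_mStar (v : V) : Fintype.card V ≤ ballCard G v (mStar G v) * mStar G v :=
  -- The radius n qualifies because balls are nonempty, so the infimum is attained.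
  Nat.sInf_mem (s := {m : ℕ | Fintype.card V ≤ ballCard G v m * m})
    ⟨Fintype.card V, Nat.le_mul_of_pos_left _ (ballCard_pos v _)⟩

lemma mStar_pos (v : V) : 0 < mStar G v := by
  have h := card_le_ballCard_mul_mStar (G := G) v
  have : 0 < Fintype.card V := Fintype.card_pos_iff.2 ⟨v⟩
  exact pos_of_mul_pos_right (this.trans_le h) (Nat.zero_le _)

/-- Minimality of m_* at radius m_* - 1. For m_* = 1 this would be a void statement about radius 0,
and the trivial bound |B_0| ≤ n takes its place. -/
lemma ballCard_pred_mul_mStar_le (v : V) :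
    ballCard G v (mStar G v - 1) * (if mStar G v = 1 then 1 else (mStar G v - 1)) ≤
      Fintype.card V := by
  split_ifs with h
  · rw [h, mul_one, ← card_ball]
    exact Finset.card_le_univ _
  · have hlt : mStar G v - 1 < mStar G v := Nat.sub_lt (mStar_pos v) one_pos
    have := Nat.notMem_of_lt_sInf hlt
    exact (not_le.1 this).le

end

/-! ### Independent Bernoulli grids -/

/-- A grid of independent events, where the probability of the event at `(j, a)` is `p a`. -/
structure IsBernoulliGrid {Ω A : Type*} [MeasurableSpace Ω] (ξ : Ω → ℕ → A → Bool) (p : A → ℝ)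
    (μ : Measure Ω) : Prop where
  meas : ∀ j a, Measurable fun ω => ξ ω j a
  indep : iIndepFun (fun (q : A × ℕ) ω => ξ ω q.2 q.1) μ
  prob : ∀ j a, μ.real {ω | ξ ω j a = true} = p a

namespace IsBernoulliGrid

variable {Ω A : Type*} [MeasurableSpace Ω] {ξ : Ω → ℕ → A → Bool} {p : A → ℝ} {μ : Measure Ω}

/-- Both functions factor through disjoint finite blocks of Boolean coordinates. On such blocks
every function is measurable, so Ψ and Φ need no measurability assumption. -/
lemma indepFun_past [Finite A] (hξ : IsBernoulliGrid ξ p μ) {β γ : Type*} [MeasurableSpace β]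
    [MeasurableSpace γ] (j : ℕ) (Ψ : (ℕ → A → Bool) → β)
    (hΨ : ∀ x y : ℕ → A → Bool, (∀ i < j, x i = y i) → Ψ x = Ψ y) (Φ : (A → Bool) → γ) :
    Measurable (fun ω => Ψ (ξ ω)) ∧ Measurable (fun ω => Φ (ξ ω j)) ∧
      IndepFun (fun ω => Ψ (ξ ω)) (fun ω => Φ (ξ ω j)) μ := by
  classical
  have := Fintype.ofFinite A
  let S : Finset (A × ℕ) := Finset.univ ×ˢ Finset.range j
  let T : Finset (A × ℕ) := Finset.univ ×ˢ {j}
  have hS : ∀ i a, i < j → (a, i) ∈ S := by simp [S]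
  have hT : ∀ a, (a, j) ∈ T := by simp [T]
  have hdisj : Disjoint S T := by
    rw [Finset.disjoint_left]
    rintro ⟨a, i⟩ h1 h2
    simp only [S, T, Finset.mem_product, Finset.mem_univ, true_and, Finset.mem_range,
      Finset.mem_singleton] at h1 h2
    omega
  have hm : ∀ q : A × ℕ, Measurable fun ω => ξ ω q.2 q.1 := fun q => hξ.meas _ _
  have hind := hξ.indep.indepFun_finset S T hdisj hm
  let Ψ' : (S → Bool) → β := fun z => Ψ fun i a => if h : i < j then z ⟨(a, i), hS i a h⟩ else false
  let Φ' : (T → Bool) → γ := fun z => Φ fun a => z ⟨(a, j), hT a⟩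
  have hΨ' : (fun ω => Ψ (ξ ω)) = Ψ' ∘ fun ω (q : S) => ξ ω q.1.2 q.1.1 := by
    funext ω
    refine hΨ _ _ fun i hi => ?_
    funext a
    simp [hi]
  have hΦ' : (fun ω => Φ (ξ ω j)) = Φ' ∘ fun ω (q : T) => ξ ω q.1.2 q.1.1 := rfl
  rw [hΨ', hΦ']
  have h1 : Measurable Ψ' := measurable_of_finite _
  have h2 : Measurable Φ' := measurable_of_finite _
  exact ⟨h1.comp (measurable_pi_lambda _ fun q => hm q),
    h2.comp (measurable_pi_lambda _ fun q => hm q), hind.comp h1 h2⟩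

lemma measurable_past [Finite A] (hξ : IsBernoulliGrid ξ p μ) {β : Type*} [MeasurableSpace β]
    (j : ℕ) (Ψ : (ℕ → A → Bool) → β)
    (hΨ : ∀ x y : ℕ → A → Bool, (∀ i < j, x i = y i) → Ψ x = Ψ y) :
    Measurable (fun ω => Ψ (ξ ω)) :=
  (hξ.indepFun_past j Ψ hΨ fun _ => ()).1

lemma measurable_cell [Finite A] (hξ : IsBernoulliGrid ξ p μ) {γ : Type*} [MeasurableSpace γ]
    (j : ℕ) (Φ : (A → Bool) → γ) : Measurable (fun ω => Φ (ξ ω j)) :=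
  (hξ.indepFun_past j (fun _ => ()) (fun _ _ _ => rfl) Φ).2.1

lemma real_inter_past [Finite A] (hξ : IsBernoulliGrid ξ p μ) (j : ℕ)
    (Ψ : (ℕ → A → Bool) → Prop)
    (hΨ : ∀ x y : ℕ → A → Bool, (∀ i < j, x i = y i) → Ψ x = Ψ y) (a : A) :
    μ.real {ω | Ψ (ξ ω) ∧ ξ ω j a = true} = μ.real {ω | Ψ (ξ ω)} * p a := by
  obtain ⟨-, -, h3⟩ := hξ.indepFun_past j Ψ hΨ fun z => z a
  have := h3.measure_inter_preimage_eq_mul {True} {true} (measurableSet_singleton _)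
    (measurableSet_singleton _)
  rw [← hξ.prob j a, measureReal_def, measureReal_def, measureReal_def, ← ENNReal.toReal_mul]
  congr 1
  convert this using 2
  · ext ω; simp
  · congr 1
    ext ω
    simp
  · rfl

lemma integral_mul_past [Finite A] (hξ : IsBernoulliGrid ξ p μ) (j : ℕ)
    (Ψ : (ℕ → A → Bool) → ℝ) (hΨ : ∀ x y : ℕ → A → Bool, (∀ i < j, x i = y i) → Ψ x = Ψ y)
    (Φ : (A → Bool) → ℝ) :
    ∫ ω, Ψ (ξ ω) * Φ (ξ ω j) ∂μ = (∫ ω, Ψ (ξ ω) ∂μ) * ∫ ω, Φ (ξ ω j) ∂μ := by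
  obtain ⟨h1, h2, h3⟩ := hξ.indepFun_past j Ψ hΨ Φ
  exact h3.integral_fun_mul_eq_mul_integral h1.aestronglyMeasurable h2.aestronglyMeasurable

lemma measurableSet_true (hξ : IsBernoulliGrid ξ p μ) (j : ℕ) (a : A) :
    MeasurableSet {ω | ξ ω j a = true} :=
  hξ.meas j a (measurableSet_singleton true)

lemma prob_nonneg (hξ : IsBernoulliGrid ξ p μ) (a : A) : 0 ≤ p a :=
  hξ.prob 0 a ▸ measureReal_nonneg

lemma real_forall_false [IsProbabilityMeasure μ] (hξ : IsBernoulliGrid ξ p μ) (j : ℕ)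
    (s : Finset A) :
    μ.real {ω | ∀ a ∈ s, ξ ω j a = false} = ∏ a ∈ s, (1 - p a) := by
  classical
  have h := hξ.indep.measure_inter_preimage_eq_mul (s.map ⟨fun a => (a, j), fun a b h => by
    simpa using h⟩) (sets := fun _ => {false}) (fun _ _ => measurableSet_singleton _)
  rw [Finset.prod_map] at h
  have h2 : ∀ a, μ.real {ω | ξ ω j a = false} = 1 - p a := fun a => by
    rw [← hξ.prob j a, ← probReal_compl_eq_one_sub (hξ.measurableSet_true j a)]
    congr 1
    ext ω
    simp
  rw [← Finset.prod_congr rfl fun a _ => h2 a]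
  simp only [measureReal_def]
  rw [← ENNReal.toReal_prod]
  congr 1
  refine Eq.trans ?_ h
  congr 1
  ext ω
  simp only [Set.mem_ofPred_eq, Finset.mem_map, Set.mem_iInter, Set.mem_preimage,
    Set.mem_singleton_iff]
  constructor
  · rintro h _ ⟨a, ha, rfl⟩
    exact h a ha
  · exact fun h a ha => h _ ⟨a, ha, rfl⟩

lemma real_forall_false_and_true [IsProbabilityMeasure μ] (hξ : IsBernoulliGrid ξ p μ) (j : ℕ)
    (s : Finset A) {b : A} (hb : b ∉ s) :
    μ.real {ω | (∀ a ∈ s, ξ ω j a = false) ∧ ξ ω j b = true} =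
      (∏ a ∈ s, (1 - p a)) * p b := by
  classical
  have h1 := hξ.real_forall_false j (insert b s)
  rw [Finset.prod_insert hb] at h1
  have h0 := hξ.real_forall_false j s
  have := measureReal_inter_add_sdiff (μ := μ) (s := {ω | ∀ a ∈ s, ξ ω j a = false})
    (hξ.measurableSet_true j b)
  have e1 : {ω | ∀ a ∈ s, ξ ω j a = false} ∩ {ω | ξ ω j b = true} =
      {ω | (∀ a ∈ s, ξ ω j a = false) ∧ ξ ω j b = true} := rfl
  have e2 : {ω | ∀ a ∈ s, ξ ω j a = false} \ {ω | ξ ω j b = true} =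
      {ω | ∀ a ∈ insert b s, ξ ω j a = false} := by
    ext ω
    simp [and_comm]
  rw [e1, e2, h1, h0] at this
  linarith

lemma real_true_and_true [IsProbabilityMeasure μ] (hξ : IsBernoulliGrid ξ p μ) (j : ℕ)
    {a b : A} (hab : a ≠ b) :
    μ.real {ω | ξ ω j a = true ∧ ξ ω j b = true} = p a * p b := by
  have h1 := hξ.real_forall_false_and_true j {a} (b := b) (by simpa using hab.symm)
  have := measureReal_inter_add_sdiff (μ := μ) (s := {ω | ξ ω j b = true}) (hξ.measurableSet_true j a)
  have e1 : {ω | ξ ω j b = true} ∩ {ω | ξ ω j a = true} =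
      {ω | ξ ω j a = true ∧ ξ ω j b = true} := by
    ext ω; simp [and_comm]
  have e2 : {ω | ξ ω j b = true} \ {ω | ξ ω j a = true} =
      {ω | (∀ a' ∈ ({a} : Finset A), ξ ω j a' = false) ∧ ξ ω j b = true} := by
    ext ω; simp [and_comm]
  rw [e1, e2, h1, hξ.prob, Finset.prod_singleton] at this
  linarith

lemma finite_range_past {A β : Type*} [Finite A] (j : ℕ) (Ψ : (ℕ → A → Bool) → β)
    (hΨ : ∀ x y : ℕ → A → Bool, (∀ i < j, x i = y i) → Ψ x = Ψ y) : (Set.range Ψ).Finite := by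
  refine (Set.finite_range fun z : Fin j → A → Bool =>
    Ψ fun i => if h : i < j then z ⟨i, h⟩ else fun _ => false).subset ?_
  rintro _ ⟨x, rfl⟩
  refine ⟨fun i => x i, hΨ _ _ fun i hi => ?_⟩
  simp [hi]

lemma integrable_past [Finite A] [IsProbabilityMeasure μ] (hξ : IsBernoulliGrid ξ p μ) (j : ℕ)
    (Ψ : (ℕ → A → Bool) → ℝ) (hΨ : ∀ x y : ℕ → A → Bool, (∀ i < j, x i = y i) → Ψ x = Ψ y) :
    Integrable (fun ω => Ψ (ξ ω)) μ := by
  obtain ⟨C, hC⟩ := (finite_range_past j (fun x => ‖Ψ x‖) fun x y h => by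
    simp only [hΨ x y h]).bddAbove
  exact Integrable.of_bound (hξ.measurable_past j Ψ hΨ).aestronglyMeasurable C
    (Eventually.of_forall fun ω => hC ⟨ξ ω, rfl⟩)

lemma integrable_cell [Finite A] [IsProbabilityMeasure μ] (hξ : IsBernoulliGrid ξ p μ) (j : ℕ)
    (Φ : (A → Bool) → ℝ) : Integrable (fun ω => Φ (ξ ω j)) μ :=
  hξ.integrable_past (j + 1) (fun x => Φ (x j)) fun x y h => by rw [h j (Nat.lt_succ_self j)]

end IsBernoulliGrid

/-! ### The grid of a family of Poisson clocks -/

/-- Whether the clock of `a` rings in the cell `(j h, (j + 1) h]`. -/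
def ringGrid {Ω A : Type*} (R : A → Ω → Set ℝ) (h : ℝ≥0) (ω : Ω) (j : ℕ) (a : A) : Bool :=
  decide (ringCount (R a) ((j + 1 : ℕ) * h) ω - ringCount (R a) (j * h) ω ≠ 0)

lemma ringGrid_eq_true_iff {Ω A : Type*} {R : A → Ω → Set ℝ} {ω : Ω}
    (hfin : ∀ a, ∀ t : ℝ, (R a ω ∩ Set.Iic t).Finite) (h : ℝ≥0) (j : ℕ) (a : A) :
    ringGrid R h ω j a = true ↔
      (R a ω ∩ Set.Ioc ((j : ℝ) * h) (((j + 1 : ℕ) : ℝ) * h)).Nonempty := by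
  have hle : ((j : ℝ) * h) ≤ (((j + 1 : ℕ) : ℝ) * h) := by gcongr; omega
  have h0 : 0 ≤ (j : ℝ) * h := by positivity
  have hf : ∀ s t : ℝ, (R a ω ∩ Set.Ioc s t).Finite := fun s t =>
    (hfin a t).subset (Set.inter_subset_inter_right _ Set.Ioc_subset_Iic_self)
  have hunion : R a ω ∩ Set.Ioc 0 (((j + 1 : ℕ) : ℝ) * h) =
      (R a ω ∩ Set.Ioc 0 ((j : ℝ) * h)) ∪
        (R a ω ∩ Set.Ioc ((j : ℝ) * h) (((j + 1 : ℕ) : ℝ) * h)) := by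
    rw [← Set.inter_union_distrib_left, Set.Ioc_union_Ioc_eq_Ioc h0 hle]
  have hcard : (R a ω ∩ Set.Ioc 0 (((j + 1 : ℕ) : ℝ) * h)).ncard =
      (R a ω ∩ Set.Ioc 0 ((j : ℝ) * h)).ncard +
        (R a ω ∩ Set.Ioc ((j : ℝ) * h) (((j + 1 : ℕ) : ℝ) * h)).ncard := by
    rw [hunion]
    refine Set.ncard_union_eq ?_ (hf _ _) (hf _ _)
    exact (Set.Ioc_disjoint_Ioc_of_le le_rfl).mono Set.inter_subset_right Set.inter_subset_right
  have hpos := Set.ncard_pos (hf ((j : ℝ) * h) (((j + 1 : ℕ) : ℝ) * h))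
  rw [← hpos]
  simp only [ringGrid, ringCount, decide_eq_true_eq, NNReal.coe_mul, NNReal.coe_natCast, hcard]
  omega

/-- Independence across clocks and independence of the increments of each clock combine to joint
independence over all pairs of a clock and a cell. -/
lemma iIndepFun_increments {Ω A : Type*} [MeasurableSpace Ω] {μ : Measure Ω}
    [IsProbabilityMeasure μ] {Y : A → ℝ≥0 → Ω → ℕ} (hY : ∀ a t, Measurable (Y a t))
    (hinc : ∀ a, HasIndepIncrements (Y a) μ)
    (hind : iIndepFun (fun a ω (t : ℝ≥0) => Y a t ω) μ) {τ : ℕ → ℝ≥0} (hτ : Monotone τ) :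
    iIndepFun (fun (q : A × ℕ) ω => Y q.1 (τ (q.2 + 1)) ω - Y q.1 (τ q.2) ω) μ := by
  have h1 : iIndepFun (fun a ω (j : ℕ) => Y a (τ (j + 1)) ω - Y a (τ j) ω) μ :=
    hind.comp (fun _ f (j : ℕ) => f (τ (j + 1)) - f (τ j)) fun _ =>
      measurable_pi_lambda _ fun j => (measurable_pi_apply _).sub (measurable_pi_apply _)
  exact iIndepFun_uncurry' (X := fun a j ω => Y a (τ (j + 1)) ω - Y a (τ j) ω)
    (fun a j => (hY a _).sub (hY a _)) h1 fun a => (hinc a).nat hτ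

lemma isBernoulliGrid_ringGrid {Ω A : Type*} [MeasurableSpace Ω] {μ : Measure Ω}
    {R : A → Ω → Set ℝ} {r : A → ℝ≥0} (hR : ∀ a, IsPoissonClock (R a) (r a) μ)
    (hind : iIndepFun (fun a ω (t : ℝ≥0) => ringCount (R a) t ω) μ) (h : ℝ≥0) :
    IsBernoulliGrid (ringGrid R h) (fun a => 1 - Real.exp (-(r a * h))) μ := by
  have hprob := hind.isProbabilityMeasure
  have hdec : Measurable fun k : ℕ => decide (k ≠ 0) := measurable_of_countable _
  have hmono : Monotone fun j : ℕ => ((j : ℝ≥0) * h) := fun i j hij => by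
    dsimp only
    gcongr
  have hmeas : ∀ a j, Measurable fun ω =>
      ringCount (R a) ((j + 1 : ℕ) * h) ω - ringCount (R a) (j * h) ω :=
    fun a j => ((hR a).measurable_count _).sub ((hR a).measurable_count _)
  have h3 := iIndepFun_increments (fun a => (hR a).measurable_count)
    (fun a => (hR a).indep_increments) hind hmono
  refine ⟨fun j a => hdec.comp (hmeas a j), h3.comp (fun _ k => decide (k ≠ 0)) fun _ => hdec, ?_⟩
  intro j a
  have hle : (j : ℝ≥0) * h ≤ ((j + 1 : ℕ) : ℝ≥0) * h := hmono (Nat.le_succ j)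
  have hlaw := (hR a).law_increment _ _ hle
  have hdiff : (((j + 1 : ℕ) : ℝ≥0) * h : ℝ≥0) - j * h = h := by
    push_cast
    rw [add_mul, one_mul, add_tsub_cancel_left]
  rw [hdiff] at hlaw
  have hzero : μ.real {ω | ringCount (R a) ((j + 1 : ℕ) * h) ω - ringCount (R a) (j * h) ω = 0} =
      Real.exp (-(r a * h)) := by
    rw [measureReal_def, hlaw.measure_eq (p := fun k => k = 0) (measurableSet_singleton 0)]
    have := poissonMeasure_real_singleton (r a * h) 0
    rw [measureReal_def] at this
    simpa using this
  have := probReal_compl_eq_one_sub (μ := μ) (hmeas a j (measurableSet_singleton 0))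
  rw [← hzero]
  refine Eq.trans ?_ this
  congr 1
  ext ω
  simp [ringGrid]

/-! ### Upper bound for the age on a grid -/

/-- `S` together with the tails of the ringing arcs that end in `S`. -/
def withTails (S : Set V) (x : Arc G → Bool) : Set V :=
  S ∪ {w | ∃ d : G.Dart, x (Sum.inr d) = true ∧ d.snd ∈ S ∧ d.fst = w}

lemma subset_withTails (S : Set V) (x : Arc G → Bool) : S ⊆ withTails S x :=
  Set.subset_union_left

lemma fst_mem_withTails {S : Set V} {x : Arc G → Bool} {d : G.Dart} (hx : x (Sum.inr d) = true)
    (hd : d.snd ∈ S) : d.fst ∈ withTails S x :=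
  Or.inr ⟨d, hx, hd, rfl⟩

open Classical in
/-- An upper bound for the smallest age in the vertex set `S`, on a time grid of mesh `h`. -/
def setAge (x : ℕ → Arc G → Bool) (h : ℝ) : ℕ → Set V → ℝ
  | 0, _ => 0
  | j + 1, S => if ∃ u ∈ S, x j (Sum.inl u) = true then 0
      else setAge x h j (withTails S (x j)) + h

lemma setAge_congr {x y : ℕ → Arc G → Bool} {h : ℝ} {j : ℕ} (hxy : ∀ i < j, x i = y i)
    (S : Set V) : setAge x h j S = setAge y h j S := by
  induction j generalizing S with
  | zero => rfl
  | succ j ih =>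
    rw [setAge, setAge, ih fun i hi => hxy i (by omega), hxy j (by omega)]

/-- Going back one cell, a fresh vertex of the enlarged set either lies in S or passes its stamp
along a ringing arc into S, at the cost of one mesh of age. -/
lemma exists_age_le_setAge [Finite V] (x : ℕ → Arc G → Bool) (h : ℝ) (j : ℕ)
    {S : Set V} (hS : S.Nonempty) :
    ∃ v ∈ S, j * h - gridStamp x h j v ≤ setAge x h j S := by
  induction j generalizing S with
  | zero =>
    obtain ⟨v, hv⟩ := hS
    exact ⟨v, hv, by simp [gridStamp, setAge]⟩
  | succ j ih =>
    rw [setAge]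
    split_ifs with hsrc
    · obtain ⟨u, hu, hxu⟩ := hsrc
      refine ⟨u, hu, sub_nonpos.2 ?_⟩
      exact tailStamp_le_update (ring := fun a => {_s : ℝ | x j a = true}) (a := Sum.inl u) _ hxu
    · obtain ⟨w, hw, hle⟩ := ih (hS.mono (subset_withTails S (x j)))
      have hj1 : ((j + 1 : ℕ) : ℝ) * h = j * h + h := by push_cast; ring
      suffices h' : ∃ v ∈ S, gridStamp x h j w ≤ gridStamp x h (j + 1) v by
        obtain ⟨v, hv, hwv⟩ := h'
        exact ⟨v, hv, by linarith⟩
      rcases hw with hw | ⟨d, hxd, hd, rfl⟩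
      · exact ⟨w, hw, le_update_self _ _ _ _⟩
      · exact ⟨d.snd, hd, tailStamp_le_update (ring := fun a => {_s : ℝ | x j a = true})
          (a := Sum.inr d) _ hxd⟩

section

variable [Fintype V]

/-- The potential that bounds the expectation of `setAge`. -/
def potential (G : SimpleGraph V) (B : Finset V) (α β : ℝ) (S : Set V) : ℝ :=
  α / B.card * ∑ u ∈ B, (stepsFrom G S u : ℝ) + β

open Classical in
omit [Fintype V] in
lemma potential_withTails_le (B : Finset V) {α : ℝ} (β : ℝ) (hα : 0 ≤ α) {S : Finset V} {v : V}
    (hv : v ∈ S) (hB : ∀ u ∈ B, G.Reachable v u) :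
    ∃ a : V → Arc G, (∀ u ∈ B, u ∉ S → ∃ d, a u = Sum.inr d) ∧
      ∀ x : Arc G → Bool, potential G B α β (withTails S x) ≤ potential G B α β S -
        α / B.card * ∑ u ∈ B \ S, (if x (a u) = true then 1 else 0 : ℝ) := by
  have hv' : v ∈ (S : Set V) := Finset.mem_coe.2 hv
  have hex : ∀ u, ∃ b : Arc G, u ∈ B → u ∉ S → ∃ d : G.Dart, b = Sum.inr d ∧ d.snd ∈ S ∧
      ∀ T : Set V, d.fst ∈ T → stepsFrom G T u + 1 ≤ stepsFrom G S u := fun u => by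
    by_cases hu : u ∈ B ∧ u ∉ S
    · obtain ⟨d, hd⟩ := exists_dart_stepsFrom_lt hv' (hB u hu.1) (fun h => hu.2 (Finset.mem_coe.1 h))
      exact ⟨Sum.inr d, fun _ _ => ⟨d, rfl, hd⟩⟩
    -- A dummy arc: the choice is only used for u in B \ S.
    · exact ⟨Sum.inl v, fun h1 h2 => absurd ⟨h1, h2⟩ hu⟩
  choose a ha using hex
  refine ⟨a, fun u h1 h2 => ?_, fun x => ?_⟩
  · obtain ⟨d, hd, -⟩ := ha u h1 h2
    exact ⟨d, hd⟩
  have hsum : ∑ u ∈ B, (stepsFrom G (withTails S x) u : ℝ) ≤ ∑ u ∈ B, (stepsFrom G S u : ℝ) -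
      ∑ u ∈ B \ S, (if x (a u) = true then 1 else 0 : ℝ) := by
    rw [Finset.sdiff_eq_filter, Finset.sum_filter, ← Finset.sum_sub_distrib]
    refine Finset.sum_le_sum fun u hu => ?_
    have h0 : (stepsFrom G (withTails S x) u : ℝ) ≤ stepsFrom G S u := by
      exact_mod_cast stepsFrom_anti (subset_withTails S x) hv' (hB u hu)
    by_cases h1 : u ∈ S
    · simpa [h1] using h0
    · rw [if_pos h1]
      split_ifs with h2
      · obtain ⟨d, hd, k1, k2⟩ := ha u hu h1
        have := k2 _ (fst_mem_withTails (hd ▸ h2) (Finset.mem_coe.2 k1))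
        rw [le_sub_iff_add_le]
        exact_mod_cast this
      · simpa using h0
  have := mul_le_mul_of_nonneg_left hsum (by positivity : 0 ≤ α / B.card)
  rw [mul_sub] at this
  simp only [potential]
  linarith

open Classical in
/-- The indicator of the event that no source arc into `S` rings. -/
def noSource (S : Set V) (x : Arc G → Bool) : ℝ := if ∃ u ∈ S, x (Sum.inl u) = true then 0 else 1

lemma noSource_nonneg (S : Set V) (x : Arc G → Bool) : 0 ≤ noSource S x := by
  rw [noSource]; split_ifs <;> simp

variable {Ω : Type*} [MeasurableSpace Ω] {μ : Measure Ω} [IsProbabilityMeasure μ]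
  {ξ : Ω → ℕ → Arc G → Bool} {p : Arc G → ℝ}

-- The recursion evaluates the past at the random set `withTails S (ξ ω j)`. Splitting according to
-- its finitely many values T makes the set deterministic, and each term factors since cell j is
-- independent of the earlier cells.
open Classical in
lemma integral_setAge_succ_le (hξ : IsBernoulliGrid ξ p μ) (h : ℝ) (j : ℕ) {S : Set V}
    {g : Set V → ℝ} (hg : ∀ T, S ⊆ T → ∫ ω, setAge (ξ ω) h j T ∂μ ≤ g T) :
    ∫ ω, setAge (ξ ω) h (j + 1) S ∂μ ≤
      ∫ ω, noSource S (ξ ω j) * (g (withTails S (ξ ω j)) + h) ∂μ := by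
  let Φ : Set V → (Arc G → Bool) → ℝ := fun T x =>
    if withTails S x = T then noSource S x else 0
  have hΦ : ∀ T x, 0 ≤ Φ T x := fun T x => by
    simp only [Φ]; split_ifs
    exacts [noSource_nonneg S x, le_rfl]
  have hpast : ∀ T, ∀ x y : ℕ → Arc G → Bool, (∀ i < j, x i = y i) →
      setAge x h j T + h = setAge y h j T + h := fun T x y hxy => by rw [setAge_congr hxy]
  have e1 : ∀ ω, setAge (ξ ω) h (j + 1) S = ∑ T, (setAge (ξ ω) h j T + h) * Φ T (ξ ω j) := by
    intro ω
    simp only [Φ, mul_ite, mul_zero, Finset.sum_ite_eq, Finset.mem_univ, if_true, setAge, noSource]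
    split_ifs <;> simp
  have e2 : ∀ ω, noSource S (ξ ω j) * (g (withTails S (ξ ω j)) + h) =
      ∑ T, (g T + h) * Φ T (ξ ω j) := by
    intro ω
    simp only [Φ, mul_ite, mul_zero, Finset.sum_ite_eq, Finset.mem_univ, if_true]
    rw [mul_comm]
  simp_rw [e1, e2]
  rw [integral_finsetSum _ fun T _ => ?_, integral_finsetSum _ fun T _ => ?_]
  · refine Finset.sum_le_sum fun T _ => ?_
    rw [hξ.integral_mul_past j _ (hpast T) (Φ T), integral_const_mul]
    by_cases hT : S ⊆ T
    · refine mul_le_mul_of_nonneg_right ?_ (integral_nonneg fun ω => hΦ T _)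
      rw [integral_add (hξ.integrable_past j (fun x => setAge x h j T) fun x y hxy =>
        by rw [setAge_congr hxy]) (integrable_const _)]
      simpa using hg T hT
    · have : ∀ x, Φ T x = 0 := fun x =>
        if_neg fun hx : withTails S x = T => hT (hx ▸ subset_withTails S x)
      simp [this]
  · exact (hξ.integrable_cell j (Φ T)).const_mul _
  · refine hξ.integrable_past (j + 1) (fun x => (setAge x h j T + h) * Φ T (x j)) ?_
    intro x y hxy
    rw [hpast T x y fun i hi => hxy i (by omega), hxy j (by omega)]

lemma integral_noSource (hξ : IsBernoulliGrid ξ p μ) (j : ℕ) (S : Finset V) :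
    ∫ ω, noSource (S : Set V) (ξ ω j) ∂μ = ∏ u ∈ S, (1 - p (Sum.inl u)) := by
  have h1 := hξ.real_forall_false j (S.map Function.Embedding.inl)
  rw [Finset.prod_map] at h1
  have h2 : MeasurableSet {ω | ∀ a ∈ S.map Function.Embedding.inl, ξ ω j a = false} := by
    have := hξ.measurable_cell j (fun x => ∀ a ∈ S.map Function.Embedding.inl, x a = false)
    exact measurableSet_setOfPred.2 this
  refine Eq.trans ?_ h1
  rw [← integral_indicator_one h2]
  congr 1
  ext ω
  by_cases hω : ∃ u ∈ S, ξ ω j (Sum.inl u) = true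
  · rw [noSource, if_pos (by exact_mod_cast hω), Set.indicator_of_notMem]
    obtain ⟨u, hu, hx⟩ := hω
    intro hall
    have := hall (Sum.inl u) (Finset.mem_map_of_mem _ hu)
    simp [hx] at this
  · rw [noSource, if_neg (by exact_mod_cast hω), Set.indicator_of_mem]
    · rfl
    · intro a ha
      obtain ⟨u, hu, rfl⟩ := Finset.mem_map.1 ha
      push Not at hω
      simpa using hω u hu

open Classical in
lemma integral_noSource_mul (hξ : IsBernoulliGrid ξ p μ) (j : ℕ) (S : Finset V) (d : G.Dart) :
    ∫ ω, noSource (S : Set V) (ξ ω j) * (if ξ ω j (Sum.inr d) = true then 1 else 0 : ℝ) ∂μ =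
      (∏ u ∈ S, (1 - p (Sum.inl u))) * p (Sum.inr d) := by
  have h1 := hξ.real_forall_false_and_true j (S.map Function.Embedding.inl) (b := Sum.inr d)
    (by simp)
  rw [Finset.prod_map] at h1
  have h2 : MeasurableSet {ω | (∀ a ∈ S.map Function.Embedding.inl, ξ ω j a = false) ∧
      ξ ω j (Sum.inr d) = true} := by
    have := hξ.measurable_cell j (fun x => (∀ a ∈ S.map Function.Embedding.inl, x a = false) ∧
      x (Sum.inr d) = true)
    exact measurableSet_setOfPred.2 this
  refine Eq.trans ?_ h1
  rw [← integral_indicator_one h2]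
  congr 1
  ext ω
  by_cases hω : ∃ u ∈ S, ξ ω j (Sum.inl u) = true
  · rw [noSource, if_pos (by exact_mod_cast hω), Set.indicator_of_notMem, zero_mul]
    obtain ⟨u, hu, hx⟩ := hω
    intro hall
    have := hall.1 (Sum.inl u) (Finset.mem_map_of_mem _ hu)
    simp [hx] at this
  · rw [noSource, if_neg (by exact_mod_cast hω), one_mul]
    split_ifs with hd
    · rw [Set.indicator_of_mem]
      · rfl
      · refine ⟨fun a ha => ?_, hd⟩
        obtain ⟨u, hu, rfl⟩ := Finset.mem_map.1 ha
        push Not at hω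
        simpa using hω u hu
    · rw [Set.indicator_of_notMem]
      exact fun hall => hd hall.2

open Classical in
/-- One step of the recursion preserves the bound by the potential. -/
lemma integral_noSource_mul_potential_le (hξ : IsBernoulliGrid ξ p μ) (j : ℕ) {h : ℝ}
    {B S : Finset V} {v : V} (hv : v ∈ S) (hB : ∀ u ∈ B, G.Reachable v u) {α β q : ℝ}
    (hα : 0 ≤ α) (hq : ∀ d, q ≤ p (Sum.inr d)) (hp : ∀ u, p (Sum.inl u) ≤ 1) :
    ∫ ω, noSource (S : Set V) (ξ ω j) * (potential G B α β (withTails S (ξ ω j)) + h) ∂μ ≤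
      (∏ u ∈ S, (1 - p (Sum.inl u))) * (potential G B α β S + h -
        α / B.card * ((B \ S).card * q)) := by
  obtain ⟨a, ha, hx⟩ := potential_withTails_le B β hα hv hB
  set Q := ∏ u ∈ S, (1 - p (Sum.inl u)) with hQ
  have hQ0 : 0 ≤ Q := Finset.prod_nonneg fun u _ => sub_nonneg.2 (hp u)
  have hle : ∀ ω, noSource (S : Set V) (ξ ω j) * (potential G B α β (withTails S (ξ ω j)) + h) ≤
      (potential G B α β S + h) * noSource (S : Set V) (ξ ω j) - α / B.card * ∑ u ∈ B \ S,
        noSource (S : Set V) (ξ ω j) * (if ξ ω j (a u) = true then 1 else 0 : ℝ) := by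
    intro ω
    have := mul_le_mul_of_nonneg_left (hx (ξ ω j)) (noSource_nonneg (S : Set V) (ξ ω j))
    rw [← Finset.mul_sum]
    linarith
  refine (integral_mono (hξ.integrable_cell j fun x => noSource (S : Set V) x *
    (potential G B α β (withTails S x) + h)) (hξ.integrable_cell j fun x =>
      (potential G B α β S + h) * noSource (S : Set V) x - α / B.card * ∑ u ∈ B \ S,
        noSource (S : Set V) x * (if x (a u) = true then 1 else 0 : ℝ)) hle).trans ?_
  rw [integral_sub ((hξ.integrable_cell j _).const_mul _)
    ((integrable_finsetSum _ fun u _ => hξ.integrable_cell j fun x =>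
      noSource (S : Set V) x * (if x (a u) = true then 1 else 0 : ℝ)).const_mul _),
    integral_const_mul, integral_const_mul, integral_noSource hξ,
    integral_finsetSum _ fun u _ => hξ.integrable_cell j fun x =>
      noSource (S : Set V) x * (if x (a u) = true then 1 else 0 : ℝ), ← hQ]
  -- Several u may share the same arc; this is harmless, because only linearity of expectation is
  -- used.
  have hsum : (B \ S).card * (Q * q) ≤ ∑ u ∈ B \ S, ∫ ω, noSource (S : Set V) (ξ ω j) *
      (if ξ ω j (a u) = true then 1 else 0 : ℝ) ∂μ := by
    rw [← nsmul_eq_mul]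
    refine Finset.card_nsmul_le_sum _ _ _ fun u hu => ?_
    rw [Finset.mem_sdiff] at hu
    obtain ⟨d, hd⟩ := ha u hu.1 hu.2
    rw [hd, integral_noSource_mul hξ]
    exact mul_le_mul_of_nonneg_left (hq d) hQ0
  have := mul_le_mul_of_nonneg_left hsum (by positivity : 0 ≤ α / B.card)
  linarith
end

/-! ### The drift inequality and the resulting upper bound -/

lemma mul_exp_neg_le_one_sub_exp_neg (z : ℝ) : z * Real.exp (-z) ≤ 1 - Real.exp (-z) := by
  have h1 := mul_le_mul_of_nonneg_right (Real.add_one_le_exp z) (Real.exp_pos (-z)).le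
  rw [← Real.exp_add, add_neg_cancel, Real.exp_zero] at h1
  linarith

/-- Here b = |B|, k = |S|, c = |B \ S|, Q is the probability that the source misses S, q bounds the
ringing probability of an edge arc from below, and g is the potential. The cost h of one cell is
split as hk/b + hc/b. -/
lemma potential_step {h lam n m b k c D η Q q g : ℝ} (hh : 0 ≤ h) (hlam : 0 < lam) (hn : 0 < n)
    (hm : 0 ≤ m) (hb : 0 < b) (hk : 0 ≤ k) (hc : 0 ≤ c) (hD : 0 < D) (hη : 0 < η) (hη1 : η ≤ 1)
    (hQ1 : Q ≤ 1) (hηQ : η ≤ Q) (hQ : k * (lam * h / n) * η ≤ 1 - Q) (hq : lam * h / D * η ≤ q)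
    (hg : m / lam / η ^ 2 ≤ g) (hnm : n ≤ b * m) (hbkc : b ≤ k + c) :
    Q * (g + h - D / lam / η ^ 2 / b * (c * q)) ≤ g := by
  -- The first share is paid by the source, which resets the age to 0.
  have h1 : h * k / b ≤ (1 - Q) * g := by
    calc h * k / b ≤ h * k * (m / n) := by
          rw [div_eq_mul_inv]
          refine mul_le_mul_of_nonneg_left ?_ (by positivity)
          rw [le_div_iff₀ hn, inv_mul_le_iff₀ hb]
          exact hnm
      _ ≤ h * k * (m / n) / η := le_div_self (by positivity) hη hη1
      _ = k * (lam * h / n) * η * (m / lam / η ^ 2) := by field_simp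
      _ ≤ (1 - Q) * g := mul_le_mul hQ hg (by positivity) (by linarith)
  -- The second share is paid by the shrinking distances. Both Q and q lose a factor η here, hence
  -- the η² in the potential.
  have h2 : h * c / b ≤ Q * (D / lam / η ^ 2 / b * (c * q)) := by
    calc h * c / b = η * (D / lam / η ^ 2 / b * (c * (lam * h / D * η))) := by field_simp
      _ ≤ Q * (D / lam / η ^ 2 / b * (c * q)) := by gcongr; linarith
  have h3 : h ≤ h * k / b + h * c / b := by
    rw [← add_div, ← mul_add, le_div_iff₀ hb]
    gcongr
  have h4 : Q * h ≤ h := mul_le_of_le_one_left hh hQ1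
  linarith

section

variable [Fintype V] [DecidableRel G.Adj] {Ω : Type*} [MeasurableSpace Ω] {μ : Measure Ω}
  [IsProbabilityMeasure μ] {ξ : Ω → ℕ → Arc G → Bool} {lam h : ℝ≥0}

lemma degree_fst_pos (d : G.Dart) : 0 < G.degree d.fst :=
  (G.degree_pos_iff_exists_adj _).2 ⟨_, d.adj⟩

lemma integral_setAge_le (hlam : 0 < lam)
    (hξ : IsBernoulliGrid ξ (fun a => 1 - Real.exp (-(yatesWeight G lam a * h))) μ) {D m : ℕ}
    (hD0 : 0 < D) (hD : ∀ w, G.degree w ≤ D) {v : V} {B : Finset V} (hBpos : 0 < B.card)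
    (hB : ∀ u ∈ B, G.Reachable v u) (hm : Fintype.card V ≤ B.card * m) (j : ℕ) {S : Set V}
    (hv : v ∈ S) :
    ∫ ω, setAge (ξ ω) h j S ∂μ ≤
      potential G B (D / lam / Real.exp (-(lam * h)) ^ 2) (m / lam / Real.exp (-(lam * h)) ^ 2)
        S := by
  classical
  set η : ℝ := Real.exp (-(lam * h)) with hη
  have hη0 : 0 < η := Real.exp_pos _
  have hη1 : η ≤ 1 := Real.exp_le_one_iff.2 (by simpa using by positivity)
  have hpot : ∀ T : Set V, (m / lam / η ^ 2 : ℝ) ≤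
      potential G B (D / lam / η ^ 2) (m / lam / η ^ 2) T := fun T => by
    rw [potential]
    exact le_add_of_nonneg_left (by positivity)
  induction j generalizing S with
  | zero =>
    refine le_trans ?_ (hpot S)
    simp only [setAge, integral_zero]
    positivity
  | succ j ih =>
    refine (integral_setAge_succ_le hξ h j fun T hT => ih (hT hv)).trans ?_
    obtain ⟨S, rfl⟩ : ∃ S' : Finset V, S = S' := ⟨S.toFinset, by simp⟩
    rw [Finset.mem_coe] at hv
    have hn : 0 < (Fintype.card V : ℝ) := by exact_mod_cast Fintype.card_pos_iff.2 ⟨v⟩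
    have hlam' : (0 : ℝ) < lam := hlam
    have hq : ∀ d : G.Dart, 1 - Real.exp (-((lam : ℝ) * h / D)) ≤
        1 - Real.exp (-(yatesWeight G lam (Sum.inr d) * h)) := by
      intro d
      have h1 : (0 : ℝ) < G.degree d.fst := by exact_mod_cast degree_fst_pos d
      have h2 : (G.degree d.fst : ℝ) ≤ D := by exact_mod_cast hD _
      have h3 : (lam : ℝ) * h / D ≤ yatesWeight G lam (Sum.inr d) * h := by
        simp only [yatesWeight, NNReal.coe_div, NNReal.coe_natCast]
        rw [div_mul_eq_mul_div]
        gcongr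
      gcongr
    refine (integral_noSource_mul_potential_le hξ j hv hB (by positivity) hq fun u =>
      sub_le_self _ (Real.exp_pos _).le).trans ?_
    have hprod : ∏ u ∈ S, (1 - (1 - Real.exp (-(yatesWeight G lam (Sum.inl u : Arc G) * h)))) =
        Real.exp (-(S.card * (lam * h / Fintype.card V))) := by
      simp only [sub_sub_cancel, yatesWeight, NNReal.coe_div, NNReal.coe_natCast,
        Finset.prod_const, ← Real.exp_nat_mul]
      congr 1
      ring
    rw [hprod]
    have hcard : (S.card : ℝ) * (lam * h / Fintype.card V) ≤ lam * h := by
      have : (S.card : ℝ) ≤ Fintype.card V := by exact_mod_cast Finset.card_le_univ S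
      calc (S.card : ℝ) * (lam * h / Fintype.card V)
          ≤ Fintype.card V * (lam * h / Fintype.card V) := by gcongr
        _ = lam * h := by field_simp
    have hηQ : η ≤ Real.exp (-(S.card * (lam * h / Fintype.card V))) :=
      Real.exp_le_exp.2 (neg_le_neg hcard)
    refine potential_step h.coe_nonneg hlam' hn (Nat.cast_nonneg m) (by exact_mod_cast hBpos)
      (Nat.cast_nonneg S.card) (Nat.cast_nonneg _) (by exact_mod_cast hD0) hη0 hη1
      (Real.exp_le_one_iff.2 (by simpa using by positivity)) hηQ ?_ ?_ (hpot _)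
      (by exact_mod_cast hm) ?_
    · exact (mul_le_mul_of_nonneg_left hηQ (by positivity)).trans
        (mul_exp_neg_le_one_sub_exp_neg _)
    · refine le_trans (mul_le_mul_of_nonneg_left ?_ (by positivity))
        (mul_exp_neg_le_one_sub_exp_neg _)
      refine Real.exp_le_exp.2 (neg_le_neg ?_)
      exact div_le_self (by positivity) (by exact_mod_cast hD0)
    · have := Finset.card_le_card (Finset.subset_union_left (s₁ := B) (s₂ := S))
      have h2 := Finset.card_union_le (B \ S) S
      rw [Finset.sdiff_union_self_eq_union] at h2
      exact_mod_cast (this.trans h2).trans_eq (add_comm _ _)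

lemma integral_gridAge_le (hlam : 0 < lam)
    (hξ : IsBernoulliGrid ξ (fun a => 1 - Real.exp (-(yatesWeight G lam a * h))) μ) {D : ℕ}
    (hD0 : 0 < D) (hD : ∀ w, G.degree w ≤ D) (v : V) (j : ℕ) :
    ∫ ω, (j * h - gridStamp (ξ ω) h j v) ∂μ ≤
      2 * D * (mStar G v / lam) / Real.exp (-(lam * h)) ^ 2 := by
  have hB : ∀ u ∈ ball G v (mStar G v), ∃ p : G.Walk v u, p.length ≤ mStar G v := fun u hu =>
    exists_walk_of_edist_le (mem_ball.1 hu)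
  have hBpos : 0 < (ball G v (mStar G v)).card := card_ball (G := G) v _ ▸ ballCard_pos v _
  have hBpos' : (0 : ℝ) < (ball G v (mStar G v)).card := by exact_mod_cast hBpos
  have h1 := integral_setAge_le hlam hξ hD0 hD hBpos (fun u hu => ⟨(hB u hu).choose⟩)
    (by rw [card_ball]; exact card_le_ballCard_mul_mStar v) j (Set.mem_singleton v)
  have hlam' : (0 : ℝ) < lam := hlam
  set m := mStar G v
  set η : ℝ := Real.exp (-(lam * h)) with hη
  have hη0 : 0 < η := Real.exp_pos _
  have h2 : ∑ u ∈ ball G v m, (stepsFrom G {v} u : ℝ) ≤ (ball G v m).card * m := by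
    rw [← nsmul_eq_mul]
    refine Finset.sum_le_card_nsmul _ _ _ fun u hu => ?_
    obtain ⟨p, hp⟩ := hB u hu
    exact_mod_cast (stepsFrom_le (Set.mem_singleton v) p).trans hp
  have hD1 : (1 : ℝ) ≤ D := by exact_mod_cast hD0
  calc ∫ ω, (j * h - gridStamp (ξ ω) h j v) ∂μ ≤ ∫ ω, setAge (ξ ω) h j {v} ∂μ := by
        refine integral_mono (hξ.integrable_past j (fun x => j * h - gridStamp x h j v)
          fun x y hxy => by rw [gridStamp_congr hxy])
          (hξ.integrable_past j (fun x => setAge x h j {v})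
          fun x y hxy => setAge_congr hxy _) fun ω => ?_
        obtain ⟨w, rfl, hw⟩ := exists_age_le_setAge (ξ ω) h j (Set.singleton_nonempty v)
        exact hw
    _ ≤ _ := h1
    _ ≤ D / lam / η ^ 2 / (ball G v m).card * ((ball G v m).card * m) + m / lam / η ^ 2 := by
        rw [potential]
        gcongr
    _ = D * (m / lam) / η ^ 2 + 1 * (m / lam) / η ^ 2 := by field_simp
    -- D + 1 ≤ 2D.
    _ ≤ D * (m / lam) / η ^ 2 + D * (m / lam) / η ^ 2 := by gcongr
    _ = 2 * D * (m / lam) / η ^ 2 := by ring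

end

/-! ### Lower bound for the age on a grid -/

/-- Whether the cells `j, …, j + i - 1` allow information to travel to `w` from outside `B`. -/
def reachedFromOutside (x : ℕ → Arc G → Bool) (B : Finset V) (j : ℕ) : ℕ → V → Prop
  | 0, w => w ∉ B
  | i + 1, w => reachedFromOutside x B j i w ∨
      ∃ d : G.Dart, d.snd = w ∧ reachedFromOutside x B j i d.fst ∧ x (j + i) (Sum.inr d) = true

lemma reachedFromOutside_congr {x y : ℕ → Arc G → Bool} {B : Finset V} {j i : ℕ}
    (hxy : ∀ k < j + i, x k = y k) (w : V) :
    reachedFromOutside x B j i w = reachedFromOutside y B j i w := by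
  induction i generalizing w with
  | zero => rfl
  | succ i ih =>
    simp only [reachedFromOutside, ih fun k hk => hxy k (by omega), hxy (j + i) (by omega)]

lemma reachedFromOutside_of_notMem (x : ℕ → Arc G → Bool) {B : Finset V} (j i : ℕ) {w : V}
    (hw : w ∉ B) : reachedFromOutside x B j i w := by
  induction i with
  | zero => exact hw
  | succ i ih => exact Or.inl ih

/-- A stamp above j h left the source after cell j - 1. It entered the graph either inside B, or
outside B and then had to travel. -/
lemma reachedFromOutside_or_source [Finite V] {x : ℕ → Arc G → Bool} {h : ℝ} (hh : 0 ≤ h)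
    (B : Finset V) {j i : ℕ} {w : V} (hw : j * h < gridStamp x h (j + i) w) :
    reachedFromOutside x B j i w ∨ ∃ k < i, ∃ u ∈ B, x (j + k) (Sum.inl u) = true := by
  induction i generalizing w with
  | zero => exact absurd hw (gridStamp_le x hh j w).not_gt
  | succ i ih =>
    have hmono : ∀ {w}, (reachedFromOutside x B j i w ∨
        ∃ k < i, ∃ u ∈ B, x (j + k) (Sum.inl u) = true) → reachedFromOutside x B j (i + 1) w ∨
        ∃ k < i + 1, ∃ u ∈ B, x (j + k) (Sum.inl u) = true := by
      rintro w (h1 | ⟨k, hk, h1⟩)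
      · exact Or.inl (Or.inl h1)
      · exact Or.inr ⟨k, by omega, h1⟩
    rw [← add_assoc, gridStamp, lt_update_iff] at hw
    rcases hw with hw | ⟨u | d, hx, rfl, hd⟩
    · exact hmono (ih hw)
    · by_cases hu : u ∈ B
      · exact Or.inr ⟨i, by omega, u, hu, hx⟩
      -- Vertices outside B count as reached from the start, so source rings there need no separate
      -- event.
      · exact Or.inl (reachedFromOutside_of_notMem x j (i + 1) hu)
    · rcases ih hd with h1 | ⟨k, hk, h1⟩
      · exact Or.inl (Or.inr ⟨d, rfl, h1, hx⟩)
      · exact Or.inr ⟨k, by omega, h1⟩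

section

variable [Fintype V] [DecidableRel G.Adj] {Ω : Type*} [MeasurableSpace Ω] {μ : Measure Ω}
  [IsProbabilityMeasure μ] {ξ : Ω → ℕ → Arc G → Bool} {p : Arc G → ℝ}

open Classical in
lemma real_reachedFromOutside_succ_le (hξ : IsBernoulliGrid ξ p μ) (B : Finset V) (j i : ℕ)
    (w : V) :
    μ.real {ω | reachedFromOutside (ξ ω) B j (i + 1) w} ≤
      μ.real {ω | reachedFromOutside (ξ ω) B j i w} +
        ∑ d : G.Dart with d.snd = w,
          μ.real {ω | reachedFromOutside (ξ ω) B j i d.fst} * p (Sum.inr d) := by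
  have hsub : {ω | reachedFromOutside (ξ ω) B j (i + 1) w} ⊆
      {ω | reachedFromOutside (ξ ω) B j i w} ∪ ⋃ d ∈ Finset.univ.filter fun d : G.Dart => d.snd = w,
        {ω | reachedFromOutside (ξ ω) B j i d.fst ∧ ξ ω (j + i) (Sum.inr d) = true} := by
    rintro ω (h1 | ⟨d, hd, h1, h2⟩)
    · exact Or.inl h1
    · exact Or.inr (Set.mem_biUnion (by simpa using hd) ⟨h1, h2⟩)
  refine (measureReal_mono hsub).trans ((measureReal_union_le _ _).trans ?_)
  refine add_le_add_right ((measureReal_biUnion_finset_le _ _).trans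
    (Finset.sum_le_sum fun d _ => ?_)) _
  rw [hξ.real_inter_past (j + i) (fun x => reachedFromOutside x B j i d.fst)
    fun x y hxy => reachedFromOutside_congr hxy _]

open Classical in
lemma card_darts_snd_eq (w : V) :
    (Finset.univ.filter fun d : G.Dart => d.snd = w).card = G.degree w := by
  rw [← G.dart_fst_fiber_card_eq_degree w]
  refine Finset.card_bij (fun d _ => d.symm) ?_ ?_ ?_
  · intro d hd
    simpa using hd
  · intro d _ d' _ h
    exact SimpleGraph.Dart.symm_involutive.injective h
  · intro d hd
    exact ⟨d.symm, by simpa using hd, by simp⟩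

/-- The weight θ^level changes by a factor of at most θ across an edge, so one cell of the union
bound multiplies it by at most 1 + Dqθ. Independence of each cell from the past gives the factor q.
-/
lemma real_reachedFromOutside_le (hξ : IsBernoulliGrid ξ p μ) (v : V) (m : ℕ) (j i : ℕ)
    {D : ℕ} (hD : ∀ w, G.degree w ≤ D) {q θ : ℝ} (hθ : 1 ≤ θ) (hq0 : 0 ≤ q)
    (hq : ∀ d, p (Sum.inr d) ≤ q) (w : V) :
    μ.real {ω | reachedFromOutside (ξ ω) (ball G v (m - 1)) j i w} ≤
      θ ^ level G v m w / θ ^ m * (1 + D * q * θ) ^ i := by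
  classical
  have hθ0 : 0 < θ := one_pos.trans_le hθ
  induction i generalizing w with
  | zero =>
    by_cases hw : w ∈ ball G v (m - 1)
    · simp only [reachedFromOutside, hw, not_true_eq_false, Set.ofPred_false, measureReal_empty]
      positivity
    -- Outside the ball of radius m - 1 the level is at least m, so the right-hand side is at least
    -- 1.
    · refine measureReal_le_one.trans ?_
      rw [pow_zero, mul_one, one_le_div (by positivity)]
      exact pow_le_pow_right₀ hθ (le_level_of_lt_edist (not_le.1 fun h => hw (mem_ball.2 h)))
  | succ i ih =>
    refine (real_reachedFromOutside_succ_le hξ _ j i w).trans ?_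
    have hsum : ∑ d : G.Dart with d.snd = w,
        μ.real {ω | reachedFromOutside (ξ ω) (ball G v (m - 1)) j i d.fst} * p (Sum.inr d) ≤
        D * (θ ^ (level G v m w + 1) / θ ^ m * (1 + D * q * θ) ^ i * q) := by
      refine (Finset.sum_le_card_nsmul _ _
        (θ ^ (level G v m w + 1) / θ ^ m * (1 + D * q * θ) ^ i * q) fun d hd => ?_).trans ?_
      · have hd' : d.snd = w := by simpa using hd
        refine mul_le_mul ((ih d.fst).trans ?_) (hq d) (hξ.prob_nonneg _) (by positivity)
        gcongr
        exact level_le_add_one (hd' ▸ d.adj) v m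
      · rw [nsmul_eq_mul, card_darts_snd_eq]
        gcongr
        exact hD w
    refine (add_le_add (ih w) hsum).trans (le_of_eq ?_)
    rw [pow_succ, pow_succ]
    ring

lemma real_lt_gridStamp_le (hξ : IsBernoulliGrid ξ p μ) (v : V) (m : ℕ) (j i : ℕ)
    {D : ℕ} (hD : ∀ w, G.degree w ≤ D) {h q θ p₀ : ℝ} (hh : 0 ≤ h) (hθ : 1 ≤ θ) (hq0 : 0 ≤ q)
    (hq : ∀ d, p (Sum.inr d) ≤ q) (hp : ∀ u, p (Sum.inl u) ≤ p₀) :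
    μ.real {ω | j * h < gridStamp (ξ ω) h (j + i) v} ≤
      (1 + D * q * θ) ^ i / θ ^ m + i * (ballCard G v (m - 1) * p₀) := by
  set B := ball G v (m - 1)
  have hsub : {ω | j * h < gridStamp (ξ ω) h (j + i) v} ⊆
      {ω | reachedFromOutside (ξ ω) B j i v} ∪
        ⋃ k ∈ Finset.range i, ⋃ u ∈ B, {ω | ξ ω (j + k) (Sum.inl u) = true} := by
    intro ω hω
    rcases reachedFromOutside_or_source hh B hω with h1 | ⟨k, hk, u, hu, h1⟩
    · exact Or.inl h1
    · exact Or.inr (Set.mem_biUnion (by simpa using hk) (Set.mem_biUnion hu h1))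
  refine (measureReal_mono hsub).trans ((measureReal_union_le _ _).trans (add_le_add ?_ ?_))
  · refine (real_reachedFromOutside_le hξ v m j i hD hθ hq0 hq v).trans (le_of_eq ?_)
    rw [level_self]
    ring
  · refine (measureReal_biUnion_finset_le _ _).trans ?_
    have : ∀ k ∈ Finset.range i, μ.real (⋃ u ∈ B, {ω | ξ ω (j + k) (Sum.inl u) = true}) ≤
        ballCard G v (m - 1) * p₀ := fun k _ => by
      refine (measureReal_biUnion_finset_le _ _).trans ?_
      refine (Finset.sum_le_card_nsmul _ _ p₀ fun u _ => ?_).trans (le_of_eq ?_)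
      · exact (hξ.prob _ _).trans_le (hp u)
      · rw [nsmul_eq_mul, card_ball]
    refine (Finset.sum_le_card_nsmul _ _ _ this).trans (le_of_eq ?_)
    rw [nsmul_eq_mul, Finset.card_range]

/-- The age is at least i h unless the stamp exceeds j h, as in Markov's inequality. The bound δ is
required only at vertices of positive degree, since isolated vertices carry no edge arcs. -/
lemma le_integral_gridAge {lam h : ℝ≥0}
    (hξ : IsBernoulliGrid ξ (fun a => 1 - Real.exp (-(yatesWeight G lam a * h))) μ)
    (v : V) (m j i : ℕ) {D δ : ℕ} (hD : ∀ w, G.degree w ≤ D) (hδ0 : 0 < δ)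
    (hδ : ∀ w, 0 < G.degree w → δ ≤ G.degree w) {θ : ℝ} (hθ : 1 ≤ θ) :
    i * h * (1 - (Real.exp (i * h * (D * (lam / δ) * θ)) / θ ^ m +
      i * h * (ballCard G v (m - 1) * (lam / Fintype.card V)))) ≤
      ∫ ω, ((j + i : ℕ) * h - gridStamp (ξ ω) h (j + i) v) ∂μ := by
  have hr : ∀ z : ℝ, 1 - Real.exp (-z) ≤ z := fun z => by
    linarith [Real.add_one_le_exp (-z)]
  have hδ' : (0 : ℝ) < δ := by exact_mod_cast hδ0
  have hlaw := real_lt_gridStamp_le hξ v m j i hD h.coe_nonneg hθ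
    (q := lam / δ * h) (by positivity) (p₀ := lam / Fintype.card V * h) (fun d => ?_) fun u => ?_
  rotate_left
  · refine (hr _).trans ?_
    have h1 : (δ : ℝ) ≤ G.degree d.fst := by exact_mod_cast hδ _ (degree_fst_pos d)
    simp only [yatesWeight, NNReal.coe_div, NNReal.coe_natCast]
    gcongr
  · exact (hr _).trans (by simp [yatesWeight])
  have hexp : (1 + D * (lam / δ * h) * θ) ^ i ≤ Real.exp (i * h * (D * (lam / δ) * θ)) := by
    have h1 : 1 + D * (lam / δ * h) * θ ≤ Real.exp (D * (lam / δ * h) * θ) := by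
      linarith [Real.add_one_le_exp (D * (lam / δ * h) * θ)]
    refine (pow_le_pow_left₀ (by positivity) h1 i).trans (le_of_eq ?_)
    rw [← Real.exp_nat_mul]
    congr 1
    ring
  have hmeas : MeasurableSet {ω | (j : ℝ) * h < gridStamp (ξ ω) h (j + i) v} :=
    measurableSet_lt measurable_const (hξ.measurable_past (j + i) (fun x => gridStamp x h (j + i) v)
      fun x y hxy => by rw [gridStamp_congr hxy])
  set F := {ω | (j : ℝ) * h < gridStamp (ξ ω) h (j + i) v}
  have hF : μ.real F ≤ Real.exp (i * h * (D * (lam / δ) * θ)) / θ ^ m +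
      i * h * (ballCard G v (m - 1) * (lam / Fintype.card V)) := by
    refine hlaw.trans (add_le_add (by gcongr) (le_of_eq (by ring)))
  calc _ ≤ i * h * (1 - μ.real F) := by gcongr
    _ = ∫ ω, Fᶜ.indicator (fun _ => (i * h : ℝ)) ω ∂μ := by
        rw [integral_indicator_const _ hmeas.compl, probReal_compl_eq_one_sub hmeas, smul_eq_mul,
          mul_comm]
    _ ≤ _ := by
        refine integral_mono ((integrable_const _).indicator hmeas.compl)
          (hξ.integrable_past (j + i) (fun x => (j + i : ℕ) * h - gridStamp x h (j + i) v)
            fun x y hxy => by rw [gridStamp_congr hxy]) fun ω => ?_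
        have h0 := gridStamp_le (ξ ω) h.coe_nonneg (j + i) v
        by_cases hω : ω ∈ F
        · rw [Set.indicator_of_notMem (by simpa using hω)]
          exact sub_nonneg.2 h0
        · rw [Set.indicator_of_mem hω]
          have : gridStamp (ξ ω) h (j + i) v ≤ j * h := not_lt.1 hω
          push_cast
          linarith

end

/-! ### Convergence of the grid dynamics -/

section

variable [Fintype V] [DecidableRel G.Adj] {Ω : Type*} [MeasurableSpace Ω] {μ : Measure Ω}
  [IsProbabilityMeasure μ] {lam : ℝ≥0} {R : Arc G → Ω → Set ℝ}

lemma yatesWeight_le (lam : ℝ≥0) (a : Arc G) : yatesWeight G lam a ≤ lam := by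
  cases a with
  | inl v =>
    refine div_le_self zero_le ?_
    exact_mod_cast Nat.one_le_iff_ne_zero.2 (Fintype.card_pos_iff.2 ⟨v⟩).ne'
  | inr d =>
    refine div_le_self zero_le ?_
    exact_mod_cast degree_fst_pos d

omit [IsProbabilityMeasure μ] in
lemma IsYatesClocks.isBernoulliGrid (hR : IsYatesClocks G lam R μ) (h : ℝ≥0) :
    IsBernoulliGrid (ringGrid R h) (fun a => 1 - Real.exp (-(yatesWeight G lam a * h))) μ :=
  isBernoulliGrid_ringGrid hR.poisson hR.indep h

lemma real_two_arcs_le (hR : IsYatesClocks G lam R μ) (h : ℝ≥0) (n : ℕ) :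
    μ.real {ω | ∃ j < n, ∃ a b, a ≠ b ∧ ringGrid R h ω j a = true ∧ ringGrid R h ω j b = true} ≤
      n * (Fintype.card (Arc G) ^ 2 * (lam * h) ^ 2) := by
  classical
  have hξ := hR.isBernoulliGrid h
  have hsub : {ω | ∃ j < n, ∃ a b, a ≠ b ∧ ringGrid R h ω j a = true ∧
      ringGrid R h ω j b = true} ⊆ ⋃ j ∈ Finset.range n,
        ⋃ q ∈ Finset.univ.filter (fun q : Arc G × Arc G => q.1 ≠ q.2),
          {ω | ringGrid R h ω j q.1 = true ∧ ringGrid R h ω j q.2 = true} := by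
    rintro ω ⟨j, hj, a, b, hab, h1, h2⟩
    exact Set.mem_biUnion (by simpa using hj)
      (Set.mem_biUnion (x := (a, b)) (by simpa using hab) ⟨h1, h2⟩)
  have hp : ∀ a : Arc G, 1 - Real.exp (-(yatesWeight G lam a * h)) ≤ lam * h := fun a => by
    have h1 := Real.add_one_le_exp (-(yatesWeight G lam a * h : ℝ))
    have h2 : (yatesWeight G lam a * h : ℝ) ≤ lam * h := by
      gcongr
      exact_mod_cast yatesWeight_le lam a
    linarith
  have hcell : ∀ j ∈ Finset.range n,
      μ.real (⋃ q ∈ Finset.univ.filter (fun q : Arc G × Arc G => q.1 ≠ q.2),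
        {ω | ringGrid R h ω j q.1 = true ∧ ringGrid R h ω j q.2 = true}) ≤
      Fintype.card (Arc G) ^ 2 * (lam * h) ^ 2 := fun j _ => by
    refine (measureReal_biUnion_finset_le _ _).trans ?_
    refine (Finset.sum_le_card_nsmul _ _ ((lam * h : ℝ) ^ 2) fun q hq => ?_).trans ?_
    · rw [hξ.real_true_and_true j (Finset.mem_filter.1 hq).2, sq]
      exact mul_le_mul (hp _) (hp _) (hξ.prob_nonneg _) (by positivity)
    · rw [nsmul_eq_mul]
      gcongr
      refine (Nat.cast_le.2 (Finset.card_le_univ _)).trans (le_of_eq ?_)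
      rw [Fintype.card_prod, sq]
      push_cast
      rfl
  refine (measureReal_mono hsub (measure_ne_top _ _)).trans
    ((measureReal_biUnion_finset_le _ _).trans ?_)
  refine (Finset.sum_le_card_nsmul _ _ _ hcell).trans (le_of_eq ?_)
  rw [nsmul_eq_mul, Finset.card_range]

/-- The mesh of the dyadic time grid with `2 ^ k` cells on `[0, t]`. -/
def mesh (t : ℝ≥0) (k : ℕ) : ℝ≥0 := t / 2 ^ k

lemma coe_mesh (t : ℝ≥0) (k : ℕ) : (mesh t k : ℝ) = t * (1 / 2) ^ k := by
  simp [mesh, div_eq_mul_inv]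

lemma two_pow_mul_mesh (t : ℝ≥0) (k : ℕ) : ((2 ^ k : ℕ) : ℝ) * mesh t k = t := by
  rw [coe_mesh]
  push_cast
  rw [mul_left_comm, ← mul_pow]
  norm_num

lemma tendsto_mesh (t : ℝ≥0) : Tendsto (fun k => (mesh t k : ℝ)) atTop (nhds 0) := by
  simp_rw [coe_mesh]
  simpa using (tendsto_pow_atTop_nhds_zero_of_lt_one (by norm_num : (0 : ℝ) ≤ 1 / 2)
    (by norm_num)).const_mul (t : ℝ)

/-- Borel–Cantelli: a cell with two ringing arcs has probability O(4^{-k}), there are 2^k cells, and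
the resulting bound O(2^{-k}) is summable. -/
lemma ae_eventually_unique_arc (hR : IsYatesClocks G lam R μ) (t : ℝ≥0) :
    ∀ᵐ ω ∂μ, ∀ᶠ k in atTop, ∀ j < 2 ^ k, ∀ a b, ringGrid R (mesh t k) ω j a = true →
      ringGrid R (mesh t k) ω j b = true → a = b := by
  have hle : ∀ k, μ {ω | ∃ j < 2 ^ k, ∃ a b, a ≠ b ∧ ringGrid R (mesh t k) ω j a = true ∧
      ringGrid R (mesh t k) ω j b = true} ≤
      ENNReal.ofReal (Fintype.card (Arc G) ^ 2 * (lam * t) ^ 2 * (1 / 2) ^ k) := fun k => by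
    rw [← ofReal_measureReal]
    refine ENNReal.ofReal_le_ofReal ((real_two_arcs_le hR (mesh t k) (2 ^ k)).trans
      (le_of_eq ?_))
    have := two_pow_mul_mesh t k
    calc ((2 ^ k : ℕ) : ℝ) * (Fintype.card (Arc G) ^ 2 * (lam * mesh t k) ^ 2)
        = Fintype.card (Arc G) ^ 2 * lam ^ 2 * (((2 ^ k : ℕ) : ℝ) * mesh t k) * mesh t k := by ring
      _ = _ := by rw [this, coe_mesh]; ring
  have hsum : ∑' k, μ {ω | ∃ j < 2 ^ k, ∃ a b, a ≠ b ∧ ringGrid R (mesh t k) ω j a = true ∧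
      ringGrid R (mesh t k) ω j b = true} ≠ ⊤ :=
    ne_top_of_le_ne_top ((summable_geometric_of_lt_one (by norm_num)
      (by norm_num : (1 / 2 : ℝ) < 1)).mul_left _).tsum_ofReal_ne_top (ENNReal.tsum_le_tsum hle)
  filter_upwards [ae_eventually_notMem hsum] with ω hω
  filter_upwards [hω] with k hk j hj a b ha hb
  by_contra hab
  exact hk ⟨j, hj, a, b, hab, ha, hb⟩

lemma ae_tendsto_gridAge (hR : IsYatesClocks G lam R μ) (v : V) (t : ℝ≥0) :
    ∀ᵐ ω ∂μ, Tendsto (fun k => ((2 ^ k : ℕ) : ℝ) * mesh t k -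
      gridStamp (ringGrid R (mesh t k) ω) (mesh t k) (2 ^ k) v) atTop
      (nhds (age (fun a => R a ω) v t)) := by
  filter_upwards [ae_eventually_unique_arc hR t] with ω hω
  have hfin : ∀ a, ∀ s : ℝ, (R a ω ∩ Set.Iic s).Finite := fun a =>
    (hR.poisson a).locallyFinite ω
  have hbound : ∀ᶠ k in atTop, dist (((2 ^ k : ℕ) : ℝ) * mesh t k -
      gridStamp (ringGrid R (mesh t k) ω) (mesh t k) (2 ^ k) v)
      (age (fun a => R a ω) v t) ≤ mesh t k := by
    filter_upwards [hω] with k hk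
    obtain ⟨h1, h2⟩ := timestamp_le_gridStamp_le (ring := fun a => R a ω)
      (fun a => (hR.poisson a).pos ω) hfin (mesh t k).coe_nonneg (n := 2 ^ k)
      (fun j _ a => ringGrid_eq_true_iff hfin (mesh t k) j a) hk (2 ^ k) le_rfl v
    rw [two_pow_mul_mesh] at h1 h2 ⊢
    rw [age, Real.dist_eq, abs_le]
    constructor <;> linarith
  exact tendsto_iff_dist_tendsto_zero.2
    (squeeze_zero' (Eventually.of_forall fun _ => dist_nonneg) hbound (tendsto_mesh t))

omit [DecidableRel G.Adj] in
lemma norm_gridAge_le (t : ℝ≥0) (k : ℕ) (v : V) (x : ℕ → Arc G → Bool) :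
    ‖((2 ^ k : ℕ) : ℝ) * mesh t k - gridStamp x (mesh t k) (2 ^ k) v‖ ≤ t := by
  have h1 := gridStamp_le x (mesh t k).coe_nonneg (2 ^ k) v
  have h2 := gridStamp_nonneg x (mesh t k) (2 ^ k) v
  rw [two_pow_mul_mesh] at h1 ⊢
  rw [Real.norm_eq_abs, abs_le]
  constructor <;> linarith [t.coe_nonneg]

omit [IsProbabilityMeasure μ] in
lemma measurable_gridAge (hR : IsYatesClocks G lam R μ) (v : V) (t : ℝ≥0) (k : ℕ) :
    Measurable fun ω => ((2 ^ k : ℕ) : ℝ) * mesh t k -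
      gridStamp (ringGrid R (mesh t k) ω) (mesh t k) (2 ^ k) v :=
  (hR.isBernoulliGrid (mesh t k)).measurable_past (2 ^ k)
    (fun x => ((2 ^ k : ℕ) : ℝ) * mesh t k - gridStamp x (mesh t k) (2 ^ k) v)
    fun x y hxy => by rw [gridStamp_congr hxy]

lemma integrable_age (hR : IsYatesClocks G lam R μ) (v : V) (t : ℝ≥0) :
    Integrable (fun ω => age (fun a => R a ω) v t) μ := by
  refine Integrable.of_bound (aestronglyMeasurable_of_tendsto_ae atTop
    (fun k => (measurable_gridAge hR v t k).aestronglyMeasurable) (ae_tendsto_gridAge hR v t)) t ?_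
  filter_upwards [ae_tendsto_gridAge hR v t] with ω hω
  exact le_of_tendsto hω.norm (Eventually.of_forall fun k => norm_gridAge_le t k v _)

lemma tendsto_integral_gridAge (hR : IsYatesClocks G lam R μ) (v : V) (t : ℝ≥0) :
    Tendsto (fun k => ∫ ω, (((2 ^ k : ℕ) : ℝ) * mesh t k -
      gridStamp (ringGrid R (mesh t k) ω) (mesh t k) (2 ^ k) v) ∂μ) atTop
      (nhds (∫ ω, age (fun a => R a ω) v t ∂μ)) :=
  tendsto_integral_of_dominated_convergence (fun _ => (t : ℝ))
    (fun k => (measurable_gridAge hR v t k).aestronglyMeasurable) (integrable_const _)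
    (fun k => Eventually.of_forall fun _ => norm_gridAge_le t k v _) (ae_tendsto_gridAge hR v t)

lemma integral_age_nonneg (hR : IsYatesClocks G lam R μ) (v : V) (t : ℝ≥0) :
    0 ≤ ∫ ω, age (fun a => R a ω) v t ∂μ :=
  ge_of_tendsto' (tendsto_integral_gridAge hR v t) fun k =>
    integral_nonneg fun _ => sub_nonneg.2 (gridStamp_le _ (mesh t k).coe_nonneg _ v)

/-! ### Bounds for the expected age -/

lemma integral_age_le (hlam : 0 < lam) (hR : IsYatesClocks G lam R μ) {D : ℕ} (hD0 : 0 < D)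
    (hD : ∀ w, G.degree w ≤ D) (v : V) (t : ℝ≥0) :
    ∫ ω, age (fun a => R a ω) v t ∂μ ≤ 2 * D * (mStar G v / lam) := by
  have hlim : Tendsto (fun k => 2 * D * (mStar G v / lam) /
      Real.exp (-(lam * mesh t k)) ^ 2 : ℕ → ℝ) atTop
      (nhds (2 * D * (mStar G v / lam) / Real.exp (-(lam * 0)) ^ 2)) := by
    refine Tendsto.div tendsto_const_nhds ?_ (by positivity)
    exact ((Real.continuous_exp.tendsto _).comp
      ((tendsto_mesh t).const_mul (lam : ℝ)).neg).pow 2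
  have := le_of_tendsto_of_tendsto' (tendsto_integral_gridAge hR v t) hlim fun k =>
    integral_gridAge_le hlam (hR.isBernoulliGrid (mesh t k)) hD0 hD v (2 ^ k)
  simpa using this

lemma le_integral_age (hR : IsYatesClocks G lam R μ) (v : V) (m : ℕ) {D δ : ℕ}
    (hD : ∀ w, G.degree w ≤ D) (hδ0 : 0 < δ) (hδ : ∀ w, 0 < G.degree w → δ ≤ G.degree w) {θ : ℝ}
    (hθ : 1 ≤ θ) {a : ℝ} {t : ℝ≥0} (ha : 0 ≤ a) (hat : a ≤ t) :
    a * (1 - (Real.exp (a * (D * (lam / δ) * θ)) / θ ^ m +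
      a * (ballCard G v (m - 1) * (lam / Fintype.card V)))) ≤
      ∫ ω, age (fun a => R a ω) v t ∂μ := by
  rcases eq_or_lt_of_le ha with rfl | ha0
  · simpa using integral_age_nonneg hR v t
  have hθ0 : 0 < θ := one_pos.trans_le hθ
  have ht0 : (0 : ℝ) < t := ha0.trans_le hat
  have hmesh : ∀ k, (0 : ℝ) < mesh t k := fun k => by rw [coe_mesh]; positivity
  -- The window of length a, rounded down to whole cells; it fits into [0, t] because a ≤ t.
  let i : ℕ → ℕ := fun k => ⌊a / mesh t k⌋₊
  have hi1 : ∀ k, (i k : ℝ) * mesh t k ≤ a := fun k =>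
    (le_div_iff₀ (hmesh k)).1 (Nat.floor_le (div_nonneg ha (hmesh k).le))
  have hi2 : ∀ k, a - mesh t k ≤ (i k : ℝ) * mesh t k := fun k => by
    have := (div_lt_iff₀ (hmesh k)).1 (Nat.lt_floor_add_one (a / mesh t k))
    rw [add_mul, one_mul] at this
    linarith
  have hi3 : ∀ k, i k ≤ 2 ^ k := fun k => by
    have : (i k : ℝ) * mesh t k ≤ ((2 ^ k : ℕ) : ℝ) * mesh t k := by
      rw [two_pow_mul_mesh]
      exact (hi1 k).trans hat
    exact_mod_cast le_of_mul_le_mul_right this (hmesh k)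
  have hlim : Tendsto (fun k => (i k : ℝ) * mesh t k) atTop (nhds a) := by
    refine tendsto_of_tendsto_of_tendsto_of_le_of_le ?_ tendsto_const_nhds hi2 hi1
    simpa using (tendsto_mesh t).const_sub a
  refine le_of_tendsto_of_tendsto' (hlim.mul_const _) (tendsto_integral_gridAge hR v t) fun k => ?_
  have := le_integral_gridAge (hR.isBernoulliGrid (mesh t k)) v m (2 ^ k - i k) (i k) hD hδ0 hδ hθ
  rw [Nat.sub_add_cancel (hi3 k)] at this
  refine le_trans ?_ this
  have := hi1 k
  -- Only the i h inside the error term is replaced by a; the leading factor keeps i h and converges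
  -- to a.
  gcongr

/-- For m = 1 the failure probability is at most 0.46 + 1/6. For m ≥ 2 one has m ≤ 2(m - 1), and it
is at most 0.46² + 1/3. -/
lemma three_tenths_le_one_sub (m : ℕ) (hm : 0 < m) {b n a y : ℝ} (hb : 0 ≤ b) (hn : 0 < n)
    (hmn : b * (if m = 1 then 1 else ((m - 1 : ℕ) : ℝ)) ≤ n) (ha : a ≤ m) (hy : y ≤ m * b / (6 * n)) :
    3 / 10 ≤ 1 - (Real.exp a / 6 ^ m + y) := by
  have he : Real.exp a / 6 ^ m ≤ (Real.exp 1 / 6) ^ m := by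
    rw [div_pow, ← Real.exp_nat_mul, mul_one]
    gcongr
  have he1 : Real.exp 1 / 6 ≤ 46 / 100 := by linarith [Real.exp_one_lt_d9]
  have he0 : 0 ≤ Real.exp 1 / 6 := by positivity
  by_cases h1 : m = 1
  · subst h1
    have : ((1 : ℕ) : ℝ) * b / (6 * n) ≤ 1 / 6 := by
      rw [div_le_div_iff₀ (by positivity) (by norm_num)]
      simp only [if_true] at hmn
      push_cast
      linarith
    rw [pow_one] at he
    linarith
  · rw [if_neg h1] at hmn
    have h2 : 2 ≤ m := by omega
    have hm2 : (m : ℝ) ≤ 2 * ((m - 1 : ℕ) : ℝ) := by exact_mod_cast (by omega : m ≤ 2 * (m - 1))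
    have : (m : ℝ) * b / (6 * n) ≤ 1 / 3 := by
      rw [div_le_div_iff₀ (by positivity) (by norm_num)]
      nlinarith
    have h3 : (Real.exp 1 / 6) ^ m ≤ (Real.exp 1 / 6) ^ 2 :=
      pow_le_pow_of_le_one he0 (by linarith) h2
    nlinarith

lemma min_le_integral_age (hlam : 0 < lam) (hR : IsYatesClocks G lam R μ) {D δ : ℕ}
    (hD : ∀ w, G.degree w ≤ D) (hδ0 : 0 < δ) (hδ : ∀ w, 0 < G.degree w → δ ≤ G.degree w)
    (hδD : δ ≤ D) (v : V) (t : ℝ≥0) :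
    1 / 20 * min ((δ : ℝ) / D) (lam * t / mStar G v) ≤
      lam * (∫ ω, age (fun a => R a ω) v t ∂μ) / mStar G v := by
  set m := mStar G v with hm
  have hm0 : 0 < m := mStar_pos v
  have hm0' : (0 : ℝ) < m := by exact_mod_cast hm0
  have hlam' : (0 : ℝ) < lam := hlam
  have hδ0' : (0 : ℝ) < δ := by exact_mod_cast hδ0
  have hδD' : (δ : ℝ) ≤ D := by exact_mod_cast hδD
  have hD0' : (0 : ℝ) < D := hδ0'.trans_le hδD'
  have hn : 0 < (Fintype.card V : ℝ) := by exact_mod_cast Fintype.card_pos_iff.2 ⟨v⟩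
  set ρ := min ((δ : ℝ) / D) (lam * t / m) with hρ
  have hρ0 : 0 ≤ ρ := le_min (by positivity) (by positivity)
  have hρ1 : ρ ≤ δ / D := min_le_left _ _
  have hρ2 : ρ ≤ lam * t / m := min_le_right _ _
  have hρ3 : ρ ≤ 1 := hρ1.trans ((div_le_one hD0').2 hδD')
  have hat : ρ * m / (6 * lam) ≤ t := by
    rw [div_le_iff₀ (by positivity)]
    rw [le_div_iff₀ hm0'] at hρ2
    nlinarith [mul_nonneg hlam'.le t.coe_nonneg]
  -- The window ρm/(6λ) makes the exponent at most m, as ρ ≤ δ/D, and fits into [0, t], as ρ ≤ λt/m.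
  -- The constant 1/20 is (1/6) · (3/10).
  have hmain := le_integral_age hR v m hD hδ0 hδ (θ := 6) (by norm_num)
    (a := ρ * m / (6 * lam)) (by positivity) hat
  have hpred : (ballCard G v (m - 1) : ℝ) * (if m = 1 then 1 else ((m - 1 : ℕ) : ℝ)) ≤
      Fintype.card V := by
    have := ballCard_pred_mul_mStar_le (G := G) v
    rw [← hm] at this
    split_ifs at this ⊢ <;> exact_mod_cast this
  have hnum := three_tenths_le_one_sub m hm0 (a := ρ * m / (6 * lam) * (D * (lam / δ) * 6))
    (y := ρ * m / (6 * lam) * (ballCard G v (m - 1) * (lam / Fintype.card V)))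
    (Nat.cast_nonneg _) hn hpred ?_ ?_
  · have h1 := (mul_le_mul_of_nonneg_left hnum (by positivity :
      (0 : ℝ) ≤ ρ * m / (6 * lam))).trans hmain
    rw [le_div_iff₀ hm0']
    calc 1 / 20 * ρ * m = lam * (ρ * m / (6 * lam) * (3 / 10)) := by ring_nf; field_simp
      _ ≤ _ := by gcongr
  · calc ρ * m / (6 * lam) * (D * (lam / δ) * 6) = ρ * (D / δ) * m := by field_simp
      _ ≤ δ / D * (D / δ) * m := by gcongr
      _ = m := by field_simp
  · calc ρ * m / (6 * lam) * (ballCard G v (m - 1) * (lam / Fintype.card V))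
        = ρ * (m * ballCard G v (m - 1) / (6 * Fintype.card V)) := by field_simp
      _ ≤ m * ballCard G v (m - 1) / (6 * Fintype.card V) :=
        mul_le_of_le_one_left (by positivity) hρ3

end

end Gossip

end

/-! ### From the two estimates to the stated constants -/

theorem theorem1p1 :
    (∀ {V : Type*} [Fintype V] (G : SimpleGraph V) [DecidableRel G.Adj] (_ : G ≠ ⊥)
        (lam : ℝ≥0) (_ : 0 < lam)
        {Ω : Type*} [MeasurableSpace Ω] (μ : Measure Ω) [IsProbabilityMeasure μ]
        (R : Gossip.Arc G → Ω → Set ℝ) (_ : Gossip.IsYatesClocks G lam R μ)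
        (v : V) (t : ℝ) (_ : 0 ≤ t),
        Integrable (fun ω => Gossip.age (fun a => R a ω) v t) μ ∧
        (1 / 20 : ℝ) *
            min (min ((G.minDegree : ℝ) / (G.maxDegree : ℝ))
                  (1 / Gossip.ballRatio G v (Gossip.mStar G v)))
                ((lam : ℝ) * t / (Gossip.mStar G v : ℝ))
          ≤ (lam : ℝ) * (∫ ω, Gossip.age (fun a => R a ω) v t ∂μ) / (Gossip.mStar G v : ℝ) ∧
        (lam : ℝ) * (∫ ω, Gossip.age (fun a => R a ω) v t ∂μ) / (Gossip.mStar G v : ℝ)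
          ≤ 3 * (G.maxDegree : ℝ)) ∧
    (∀ D : ℕ, ∃ c C : ℝ, 0 < c ∧ 0 < C ∧
      ∀ {V : Type*} [Fintype V] (G : SimpleGraph V) [DecidableRel G.Adj] (_ : G.maxDegree ≤ D)
        (lam : ℝ≥0) (_ : 0 < lam)
        {Ω : Type*} [MeasurableSpace Ω] (μ : Measure Ω) [IsProbabilityMeasure μ]
        (R : Gossip.Arc G → Ω → Set ℝ) (_ : Gossip.IsYatesClocks G lam R μ)
        (v : V),
        ∀ᶠ t : ℝ in atTop,
          c * ((Gossip.mStar G v : ℝ) / (lam : ℝ))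
              ≤ ∫ ω, Gossip.age (fun a => R a ω) v t ∂μ ∧
          ∫ ω, Gossip.age (fun a => R a ω) v t ∂μ
              ≤ C * ((Gossip.mStar G v : ℝ) / (lam : ℝ))) := by
  refine ⟨?_, fun D => ⟨1 / (20 * (D + 1)), 2 * (D + 1), by positivity, by positivity, ?_⟩⟩
  · intro V _ G _ hG lam hlam Ω _ μ _ R hR v t ht
    lift t to ℝ≥0 using ht
    have hm : (0 : ℝ) < Gossip.mStar G v := by exact_mod_cast Gossip.mStar_pos v
    have hlam' : (0 : ℝ) < lam := hlam
    have hD0 : 0 < G.maxDegree := by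
      obtain ⟨u, w, huw⟩ := SimpleGraph.ne_bot_iff_exists_adj.1 hG
      exact ((G.degree_pos_iff_exists_adj u).2 ⟨w, huw⟩).trans_le (G.degree_le_maxDegree u)
    refine ⟨Gossip.integrable_age hR v t, ?_, ?_⟩
    -- With an isolated vertex δ = 0, and the lower bound only says that the expected age is
    -- nonnegative.
    · rcases Nat.eq_zero_or_pos G.minDegree with hδ | hδ
      · refine le_trans ?_ (div_nonneg (mul_nonneg hlam'.le
          (Gossip.integral_age_nonneg hR v t)) hm.le)
        refine mul_nonpos_of_nonneg_of_nonpos (by norm_num) ?_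
        exact (min_le_left _ _).trans ((min_le_left _ _).trans (by simp [hδ]))
      · refine le_trans ?_ (Gossip.min_le_integral_age hlam hR G.degree_le_maxDegree hδ
          (fun w _ => G.minDegree_le_degree w)
          ((G.minDegree_le_degree v).trans (G.degree_le_maxDegree v)) v t)
        gcongr
        exact min_le_left _ _
    · have := Gossip.integral_age_le hlam hR hD0 G.degree_le_maxDegree v t
      rw [div_le_iff₀ hm]
      calc (lam : ℝ) * ∫ ω, Gossip.age (fun a => R a ω) v t ∂μ
          ≤ lam * (2 * G.maxDegree * (Gossip.mStar G v / lam)) := by gcongr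
        _ = 2 * G.maxDegree * Gossip.mStar G v := by field_simp
        _ ≤ 3 * G.maxDegree * Gossip.mStar G v := by gcongr; norm_num
  · intro V _ G _ hG lam hlam Ω _ μ _ R hR v
    have hm : (0 : ℝ) < Gossip.mStar G v := by exact_mod_cast Gossip.mStar_pos v
    have hlam' : (0 : ℝ) < lam := hlam
    -- D + 1 instead of D keeps the degree bound positive for edgeless graphs. The lower bound then
    -- takes δ = 1, which every nonzero degree satisfies.
    have hD : ∀ w, G.degree w ≤ D + 1 := fun w =>
      ((G.degree_le_maxDegree w).trans hG).trans (Nat.le_succ D)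
    -- From this time on λt/m_* ≥ 1, so the minimum in the lower bound is 1/(D + 1).
    filter_upwards [eventually_ge_atTop ((Gossip.mStar G v : ℝ) / lam)] with t ht
    lift t to ℝ≥0 using (by positivity : (0 : ℝ) ≤ Gossip.mStar G v / lam).trans ht
    constructor
    · have h1 := Gossip.min_le_integral_age hlam hR hD one_pos (fun _ h => h) (by omega) v t
      have h2 : (1 : ℝ) ≤ lam * t / Gossip.mStar G v := by
        rw [le_div_iff₀ hm, one_mul, mul_comm]
        exact (div_le_iff₀ hlam').1 ht
      have h3 : ((1 : ℕ) : ℝ) / ((D + 1 : ℕ) : ℝ) ≤ 1 := by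
        rw [div_le_one (by positivity)]
        exact_mod_cast Nat.le_add_left 1 D
      rw [min_eq_left (h3.trans h2), le_div_iff₀ hm] at h1
      rw [← mul_div_assoc, div_le_iff₀ hlam', mul_comm (∫ _, _ ∂_)]
      refine le_trans (le_of_eq ?_) h1
      push_cast
      field_simp
    · have := Gossip.integral_age_le hlam hR (Nat.succ_pos D) hD v t
      simpa using this
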